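/- **Setting.** Let $0<\mu<1$, $0\le\nu\le1$, $\lambda=\mu+\nu-\mu\nu$, $0=t_0<t_1<\dots<t_n<t_{n+1}=T$, and let $E$ be a Banach space. Let $A$ be the infinitesimal generator of a compact $C_0$-semigroup $(Q(t))_{t\ge0}$ on $E$ with $M:=\sup_{t\ge0}\|Q(t)\|<\infty$. Let $\Lambda$ be a compact Polish space, $x_0\in E$, $\phi_k:[0,T]\times E\to E$ $(1\le k\le n)$ and $g:[0,T]\times E\times\Lambda\to E$. A relaxed control is a map $v$ on $[0,T]$ such that $v(t)$ is a Borel probability measure on $\Lambda$ for a.e. $t$ and $t\mapsto\int_\Lambda f\,dv(t)$ is measurable for every $f\in C(\Lambda)$. Put $$P_\mu(t)=\int_0^\infty\mu\theta\,\xi_\mu(\theta)\,Q(t^\mu\theta)\,d\theta,\qquad S_{\mu,\nu}(t)=I_{0+}^{\nu(1-\mu)}\big[s^{\mu-1}P_\mu(s)\big](t),$$ where $I_{0+}^{a}f(t)=\frac1{\Gamma(a)}\int_0^t(t-s)^{a-1}f(s)\,ds$ for $a>0$, $I^0_{0+}f=f$, and $$\xi_\mu(\theta)=\tfrac1\mu\theta^{-1-\frac1\mu}\varpi_\mu(\theta^{-\frac1\mu}),\qquad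 \varpi_\mu(\theta)=\tfrac1\pi\sum_{m=1}^\infty(-1)^{m-1}\theta^{-m\mu-1}\tfrac{\Gamma(m\mu+1)}{m!}\sin(m\pi\mu).$$ $PC_{1-\lambda}([0,T],E)$ is the space of functions $x$ for which $(t-t_k)^{1-\lambda}x(t)$ is continuous and bounded on $(t_k,t_{k+1}]$ for $k=0,\dots,n$, with norm $$\|x\|_{PC_{1-\lambda}}=\max_{0\le k\le n}\ \sup_{t\in(t_k,t_{k+1}]}(t-t_k)^{1-\lambda}\|x(t)\|.$$ A trajectory of the relaxed control system $$D_{0+}^{\mu,\nu}x(t)=Ax(t)+\int_\Lambda g(t,x(t),\eta)\,v(t)(d\eta)\ (t\ne t_k),\quad I^{1-\lambda}_{0+}x(0)=x_0,\quad \Delta I_{t_k}^{1-\lambda}x(t_k)=\phi_k(t_k^-,x(t_k^-))$$ with relaxed control $v$ is a mild solution: $x\in PC_{1-\lambda}([0,T],E)$ such that, for $t\in(t_k,t_{k+1}]$, $0\le k\le n$, $$x(t)=S_{\mu,\nu}(t)x_0+\sum_{i=1}^kS_{\mu,\nu}(t-t_i)\phi_i(t_i,x(t_i^-))+\int_0^t(t-s)^{\mu-1}P_\mu(t-s)\int_\Lambda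 g(s,x(s),\eta)\,v(s)(d\eta)\,ds .$$ **Hypotheses.** Let $p>1/\mu$. (1) $g(\cdot,x,\eta)$ is measurable for all $x,\eta$, and $g(t,\cdot,\cdot)$ is continuous for all $t$. There are $\alpha_r\in L^p([0,T],\mathbb R^+)$, $\beta_r\ge0$, $L_r>0$ such that, for $0\le k\le n$ and all $x,y\in E$, $\eta\in\Lambda$: $\|g(t,x,\eta)\|\le\alpha_r(t)+\beta_r(t-t_k)^{1-\lambda}\|x\|$ for a.e. $t\in(t_k,t_{k+1}]$, and $\|g(t,x,\eta)-g(t,y,\eta)\|\le L_r(t-t_k)^{1-\lambda}\|x-y\|$ for all $t\in(t_k,t_{k+1}]$. (2) For $1\le k\le n$ there is $h_k>0$ with $2Mh_k\sum_{i=1}^k(t_i-t_{i-1})^{\lambda-1}<\Gamma(\lambda)$ and $\|\phi_k(t_k,x)-\phi_k(t_k,y)\|\le h_k\|x-y\|$ for all $x,y\in E$. For $0\le k\le n$ set $w_k=1-\frac{M}{\Gamma(\lambda)}\sum_{i=1}^kh_i(t_i-t_{i-1})^{\lambda-1}$ and $$\tau_k=\frac{M\|x_0\|}{\Gamma(\lambda)}+\frac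 M{\Gamma(\lambda)}\sum_{i=1}^k\|\phi_i(t_i,0)\|+\frac{M\,T^{\nu(\mu-1)+1-\frac1p}}{\Gamma(\mu)}\Big(\frac{p-1}{p\mu-1}\Big)^{1-\frac1p}\|\alpha_r\|_{L^p([0,T])},$$ and let $E_\mu(z)=\sum_{m\ge0}z^m/\Gamma(\mu m+1)$. **Claim.** There is a constant $D$, independent of the relaxed control, such that $\|x\|_{PC_{1-\lambda}}\le D$ for every relaxed control $v$ and every trajectory $x$ with control $v$. Moreover, every such $x$ satisfies $$\sup_{t\in(0,t_1]}t^{1-\lambda}\|x(t)\|\le D_1=\tau_0\,E_\mu\big(MT^{1+\nu(\mu-1)}L_r\big)$$ and, for each $k\in\{1,\dots,n\}$ with $w_k>0$, $$\sup_{t\in(t_k,t_{k+1}]}(t-t_k)^{1-\lambda}\|x(t)\|\le D_2=\frac{\tau_k}{w_k}\,E_\mu\Big(\frac{MT^{1+\nu(\mu-1)}L_r}{w_k}\Big).$$ -/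

import Mathlib

open MeasureTheory Set Filter Topology

noncomputable section

namespace HilferRelaxed

section Functions

/-- The one-parameter Mittag-Leffler function `E_μ(z) = ∑ zⁿ / Γ(μ n + 1)`. -/
def mittagLeffler (μ z : ℝ) : ℝ := ∑' n : ℕ, z ^ n / Real.Gamma (μ * n + 1)

/-- The one-sided stable density
`ϖ_μ(θ) = (1/π) ∑_{n ≥ 1} (-1)^{n-1} θ^{-nμ-1} (Γ(nμ+1)/n!) sin(nπμ)`
(the summation index below is `n - 1`). -/
def stableDensity (μ θ : ℝ) : ℝ :=
  (1 / Real.pi) * ∑' n : ℕ, (-1 : ℝ) ^ n * θ ^ (-((n + 1 : ℕ) : ℝ) * μ - 1) *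
    (Real.Gamma (((n + 1 : ℕ) : ℝ) * μ + 1) / ((n + 1).factorial : ℝ)) *
    Real.sin (((n + 1 : ℕ) : ℝ) * Real.pi * μ)

/-- `ξ_μ(θ) = (1/μ) θ^{-1-1/μ} ϖ_μ(θ^{-1/μ})`. -/
def xi (μ θ : ℝ) : ℝ :=
  (1 / μ) * θ ^ (-1 - 1 / μ) * stableDensity μ (θ ^ (-(1 / μ)))

/-- `λ = μ + ν - μ ν`. -/
def hlam (μ ν : ℝ) : ℝ := μ + ν - μ * ν

end Functions

section Operators

variable {E : Type*} [NormedAddCommGroup E] [NormedSpace ℝ E]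

/-- The Riemann-Liouville fractional integral
`I^a f (t) = (1/Γ(a)) ∫_0^t (t-s)^{a-1} f(s) ds` for `a > 0`, with `I^0 f = f`. -/
def fracInt (a : ℝ) (f : ℝ → E) (t : ℝ) : E :=
  if a = 0 then f t
  else (1 / Real.Gamma a) • ∫ s in Ioc 0 t, (t - s) ^ (a - 1) • f s

/-- `Q(t)`, `t ≥ 0`, is a `C₀`-semigroup of bounded operators. -/
structure IsC0Semigroup (Q : ℝ → E →L[ℝ] E) : Prop where
  zero : Q 0 = ContinuousLinearMap.id ℝ E
  add : ∀ s t : ℝ, 0 ≤ s → 0 ≤ t → Q (s + t) = (Q s).comp (Q t)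
  strongly_continuous : ∀ x : E, ContinuousOn (fun t => Q t x) (Ici 0)

/-- `A`, with its domain, is the infinitesimal generator of `Q`. -/
def IsGenerator (A : E →ₗ.[ℝ] E) (Q : ℝ → E →L[ℝ] E) : Prop :=
  ∀ x y : E, (x, y) ∈ A.graph ↔
    Tendsto (fun h : ℝ => h⁻¹ • (Q h x - x)) (𝓝[>] 0) (𝓝 y)

/-- `M = sup_{t ≥ 0} ‖Q(t)‖`. -/
def semigroupBound (Q : ℝ → E →L[ℝ] E) : ℝ := sSup ((fun t => ‖Q t‖) '' Ici 0)

/-- `P_μ(t) x = ∫_0^∞ μ θ ξ_μ(θ) Q(t^μ θ) x dθ`. -/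
def opP (Q : ℝ → E →L[ℝ] E) (μ t : ℝ) (x : E) : E :=
  ∫ θ in Ioi (0 : ℝ), (μ * θ * xi μ θ) • Q (t ^ μ * θ) x

/-- `S_{μ,ν}(t) x = I^{ν(1-μ)} [s ↦ s^{μ-1} P_μ(s) x] (t)`. -/
def opS (Q : ℝ → E →L[ℝ] E) (μ ν t : ℝ) (x : E) : E :=
  fracInt (ν * (1 - μ)) (fun s => s ^ (μ - 1) • opP Q μ s x) t

end Operators

section PiecewiseContinuous

variable {E : Type*} [NormedAddCommGroup E] [NormedSpace ℝ E]

/-- `0 = t₀ < t₁ < ⋯ < tₙ < tₙ₊₁ = T`. -/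
structure IsPartition (n : ℕ) (T : ℝ) (t : ℕ → ℝ) : Prop where
  left : t 0 = 0
  lt : ∀ k ≤ n, t k < t (k + 1)
  right : t (n + 1) = T

/-- Membership in `PC_{1-λ}([0,T],E)`: for every `k = 0, …, n` the function
`s ↦ (s-t_k)^{1-λ} x(s)` is continuous on `(t_k, t_{k+1}]` and bounded there. -/
structure MemPC (lam : ℝ) (n : ℕ) (t : ℕ → ℝ) (x : ℝ → E) : Prop where
  continuousOn : ∀ k ≤ n,
    ContinuousOn (fun s => (s - t k) ^ (1 - lam) • x s) (Ioc (t k) (t (k + 1)))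
  bounded : ∀ k ≤ n,
    BddAbove ((fun s => (s - t k) ^ (1 - lam) * ‖x s‖) '' Ioc (t k) (t (k + 1)))

/-- `sup_{s ∈ (t_k,t_{k+1}]} (s-t_k)^{1-λ} ‖x(s)‖`. -/
def pieceNorm (lam : ℝ) (t : ℕ → ℝ) (k : ℕ) (x : ℝ → E) : ℝ :=
  sSup ((fun s => (s - t k) ^ (1 - lam) * ‖x s‖) '' Ioc (t k) (t (k + 1)))

/-- The norm of `PC_{1-λ}([0,T],E)`: the maximum over `k = 0, …, n` of the weighted suprema. -/
def pcNorm (lam : ℝ) (n : ℕ) (t : ℕ → ℝ) (x : ℝ → E) : ℝ :=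
  (Finset.range (n + 1)).sup' ⟨0, Finset.mem_range.2 n.succ_pos⟩ (fun k => pieceNorm lam t k x)

end PiecewiseContinuous

section Control

variable {E : Type*} [NormedAddCommGroup E] [NormedSpace ℝ E]
variable {Λ : Type*} [TopologicalSpace Λ] [MeasurableSpace Λ]

/-- Relaxed controls `v ∈ R([0,T], M(Λ))`: `v(t)` is a probability measure for a.e. `t`, and
`t ↦ ∫ f dv(t)` is Lebesgue measurable for all `f ∈ C(Λ)`. -/
structure IsRelaxedControl (T : ℝ) (v : ℝ → Measure Λ) : Prop where
  prob : ∀ᵐ s ∂(volume.restrict (Icc 0 T)), IsProbabilityMeasure (v s)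
  meas : ∀ f : C(Λ, ℝ),
    AEMeasurable (fun s => ∫ η, f η ∂(v s)) (volume.restrict (Icc 0 T))

/-- `G(s,x)σ = ∫_Λ g(s,x,η) σ(dη)`. -/
def relaxedField (g : ℝ → E → Λ → E) (s : ℝ) (x : E) (σ : Measure Λ) : E :=
  ∫ η, g s x η ∂σ

/-- The assumptions on the nonlinearity `g : [0,T] × E × Λ → E`. -/
structure HypG (n : ℕ) (T : ℝ) (t : ℕ → ℝ) (lam p : ℝ) (g : ℝ → E → Λ → E)
    (α : ℝ → ℝ) (β L : ℝ) : Prop where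
  meas : ∀ x η, AEStronglyMeasurable (fun s => g s x η) (volume.restrict (Icc 0 T))
  cont : ∀ s ∈ Icc 0 T, Continuous (fun q : E × Λ => g s q.1 q.2)
  α_nonneg : ∀ s ∈ Icc 0 T, 0 ≤ α s
  α_memLp : MemLp α (ENNReal.ofReal p) (volume.restrict (Icc 0 T))
  β_nonneg : 0 ≤ β
  growth : ∀ k ≤ n, ∀ᵐ s ∂(volume.restrict (Ioc (t k) (t (k + 1)))), ∀ x η,
    ‖g s x η‖ ≤ α s + β * (s - t k) ^ (1 - lam) * ‖x‖
  L_pos : 0 < L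
  lipschitz : ∀ k ≤ n, ∀ s ∈ Ioc (t k) (t (k + 1)), ∀ x y η,
    ‖g s x η - g s y η‖ ≤ L * (s - t k) ^ (1 - lam) * ‖x - y‖

/-- The assumptions on the impulses `φ_k`, `k = 1, …, n`:
`0 < h_k < Γ(λ) / (2 M ∑_{i=1}^k (t_i - t_{i-1})^{λ-1})`, written without division,
and `φ_k(t_k, ·)` is `h_k`-Lipschitz. -/
structure HypH (n : ℕ) (t : ℕ → ℝ) (lam M : ℝ) (φ : ℕ → ℝ → E → E) (h : ℕ → ℝ) : Prop where
  pos : ∀ k, 1 ≤ k → k ≤ n → 0 < h k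
  small : ∀ k, 1 ≤ k → k ≤ n →
    h k * (2 * M * ∑ i ∈ Finset.range k, (t (i + 1) - t i) ^ (lam - 1)) < Real.Gamma lam
  lipschitz : ∀ k, 1 ≤ k → k ≤ n → ∀ x y,
    ‖φ k (t k) x - φ k (t k) y‖ ≤ h k * ‖x - y‖

/-- `x` is a trajectory (mild solution) of the relaxed impulsive system with control `v`:
`x ∈ PC_{1-λ}` and, for `s ∈ (t_k, t_{k+1}]`, `k = 0, …, n`,
`x(s) = S(s) x₀ + ∑_{i=1}^k S(s-t_i) φ_i(t_i, x(t_i⁻)) + ∫_0^s (s-r)^{μ-1} P(s-r) G(r,x(r))v(r) dr`.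
Members of `PC_{1-λ}` are continuous from the left at `t_i`, so that `x(t_i⁻) = x(t_i)`. -/
structure IsRelaxedTrajectory (n : ℕ) (t : ℕ → ℝ) (μ ν : ℝ) (Q : ℝ → E →L[ℝ] E)
    (g : ℝ → E → Λ → E) (φ : ℕ → ℝ → E → E) (x₀ : E) (v : ℝ → Measure Λ) (x : ℝ → E) :
    Prop where
  memPC : MemPC (hlam μ ν) n t x
  integrable : ∀ k ≤ n, ∀ s ∈ Ioc (t k) (t (k + 1)),
    IntegrableOn (fun r => (s - r) ^ (μ - 1) • opP Q μ (s - r) (relaxedField g r (x r) (v r)))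
      (Ioc 0 s)
  eq : ∀ k ≤ n, ∀ s ∈ Ioc (t k) (t (k + 1)),
    x s = opS Q μ ν s x₀ + ∑ i ∈ Finset.Icc 1 k, opS Q μ ν (s - t i) (φ i (t i) (x (t i))) +
      ∫ r in Ioc 0 s, (s - r) ^ (μ - 1) • opP Q μ (s - r) (relaxedField g r (x r) (v r))

end Control

section Constants

variable {E : Type*} [NormedAddCommGroup E] [NormedSpace ℝ E]

/-- The number `τ = τ_k` belonging to the interval `(t_k, t_{k+1}]` (for `k = 0` the sum is
empty). -/
def tau (T : ℝ) (t : ℕ → ℝ) (μ ν p M : ℝ) (φ : ℕ → ℝ → E → E) (x₀ : E) (α : ℝ → ℝ)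
    (k : ℕ) : ℝ :=
  M * ‖x₀‖ / Real.Gamma (hlam μ ν) +
    M / Real.Gamma (hlam μ ν) * ∑ i ∈ Finset.Icc 1 k, ‖φ i (t i) 0‖ +
    M * T ^ (ν * (μ - 1) + 1 - 1 / p) / Real.Gamma μ *
      ((p - 1) / (p * μ - 1)) ^ (1 - 1 / p) *
      (eLpNorm α (ENNReal.ofReal p) (volume.restrict (Icc 0 T))).toReal

/-- `w = w_k = 1 - (M/Γ(λ)) ∑_{i=1}^k h_i (t_i - t_{i-1})^{λ-1}`. -/
def wk (t : ℕ → ℝ) (lam M : ℝ) (h : ℕ → ℝ) (k : ℕ) : ℝ :=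
  1 - M / Real.Gamma lam *
    ∑ i ∈ Finset.range k, h (i + 1) * (t (i + 1) - t i) ^ (lam - 1)

end Constants

end HilferRelaxed

end

open HilferRelaxed

namespace HilferRelaxed

/-! The proof reduces the claim to a scalar Volterra inequality with impulses for the weighted norm
of a trajectory, which is then solved by Picard iteration. The explicit constants require `‖P_μ(t)‖
≤ M / Γ(μ)` with exactly this constant, hence two facts about the series defining `ϖ_μ`: it is
nonnegative, and `∫ μ θ ξ_μ(θ) dθ = 1 / Γ(μ)`.

Both come from writing `π ϖ_μ(x)` as the imaginary part of `∫ exp(xσ - σ^μ) dσ` along a ray of angle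
`φ` (`stableDensity_eq_integral_ray`). If `cos φ < 0 < cos(μφ)`, Fubini gives the moment
(`integral_rpow_mul_stableDensity`). Letting `φ` decrease to `π/2` gives a Fourier integral of
`exp(-(ir)^μ)`. This symbol is a limit of `(1 - (1 - z)^μ)^n` with `z = exp(-s n^(-1/μ))`, and `1 -
(1 - z)^μ` has nonnegative Taylor coefficients. After Gaussian regularisation each Taylor term
contributes a nonnegative amount (`stableDensity_nonneg`).

The Beta integral then bounds `S_{μ,ν}(t)` by `M t^(λ-1) / Γ(λ)`. Multiplying the mild formula by
`(s - t_k)^(1-λ)` and using Hölder's inequality for `α` yields `weighted_norm_le_of_trajectory`,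
valid for every majorant `u` of the weighted norm. The exact iterates `volterraIterate` start at a
constant majorant and converge to a Mittag-Leffler function. If `w_k > 0`, the impulses consume at
most the fraction `1 - w_k` of the current iterate, whence the divisions by `w_k`. Without this
condition, a uniform bound follows interval by interval, earlier intervals bounding the impulses. -/

/-! ### The Gamma integral in the right half-plane. -/

lemma integrableOn_rpow_mul_exp_neg_mul {a b : ℝ} (ha : 0 < a) (hb : 0 < b) :
    IntegrableOn (fun r : ℝ => r ^ (a - 1) * Real.exp (-b * r)) (Ioi 0) := by
  simpa using integrableOn_rpow_mul_exp_neg_mul_rpow (p := 1) (s := a - 1) (b := b)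
    (by linarith) one_pos hb

lemma norm_rpow_mul_cexp (a : ℝ) (w : ℂ) {r : ℝ} (hr : 0 < r) :
    ‖((r ^ (a - 1) : ℝ) : ℂ) * Complex.exp (-(w * r))‖ =
      r ^ (a - 1) * Real.exp (-w.re * r) := by
  rw [norm_mul, Complex.norm_exp, Complex.norm_real, Real.norm_of_nonneg (by positivity)]
  simp

lemma measurable_rpow_mul_cexp (a : ℝ) (w : ℂ) :
    Measurable (fun r : ℝ => ((r ^ (a - 1) : ℝ) : ℂ) * Complex.exp (-(w * r))) := by
  fun_prop

lemma integrableOn_rpow_mul_cexp {a : ℝ} (ha : 0 < a) {w : ℂ} (hw : 0 < w.re) :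
    IntegrableOn (fun r : ℝ => ((r ^ (a - 1) : ℝ) : ℂ) * Complex.exp (-(w * r))) (Ioi 0) := by
  refine Integrable.mono' (integrableOn_rpow_mul_exp_neg_mul ha hw)
    (measurable_rpow_mul_cexp a w).aestronglyMeasurable ?_
  filter_upwards [ae_restrict_mem measurableSet_Ioi] with r hr
  rw [norm_rpow_mul_cexp a w hr]

/-- Differentiation under the integral sign: on `Re z > Re w / 2` the derivative is dominated by
`r^a exp(-(Re w / 2) r)`. -/
lemma differentiableOn_integral_rpow_mul_cexp {a : ℝ} (ha : 0 < a) :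
    DifferentiableOn ℂ (fun w : ℂ => ∫ r in Ioi (0 : ℝ),
      ((r ^ (a - 1) : ℝ) : ℂ) * Complex.exp (-(w * r))) {w | 0 < w.re} := by
  intro w (hw : 0 < w.re)
  have hnhds : {z : ℂ | w.re / 2 < z.re} ∈ 𝓝 w :=
    (isOpen_lt continuous_const Complex.continuous_re).mem_nhds (by simp; linarith)
  refine (hasDerivAt_integral_of_dominated_loc_of_deriv_le
    (μ := volume.restrict (Ioi (0 : ℝ)))
    (F := fun z r => ((r ^ (a - 1) : ℝ) : ℂ) * Complex.exp (-(z * r)))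
    (bound := fun r : ℝ => r ^ (a + 1 - 1) * Real.exp (-(w.re / 2) * r))
    (F' := fun z r => -(((r ^ (a + 1 - 1) : ℝ) : ℂ) * Complex.exp (-(z * r)))) hnhds ?_
    (integrableOn_rpow_mul_cexp ha hw) ?_ ?_ ?_ ?_).2.differentiableAt.differentiableWithinAt
  · exact Eventually.of_forall fun z => (measurable_rpow_mul_cexp a z).aestronglyMeasurable
  · exact (measurable_rpow_mul_cexp (a + 1) w).neg.aestronglyMeasurable
  · filter_upwards [ae_restrict_mem measurableSet_Ioi] with r (hr : 0 < r) z (hz : _ < _)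
    rw [norm_neg, norm_rpow_mul_cexp _ _ hr]
    gcongr
  · exact integrableOn_rpow_mul_exp_neg_mul (by linarith) (by linarith)
  · filter_upwards [ae_restrict_mem measurableSet_Ioi] with r (hr : 0 < r) z _
    have h := (((hasDerivAt_id z).mul_const (r : ℂ)).neg.cexp).const_mul ((r ^ (a - 1) : ℝ) : ℂ)
    convert! h using 1
    rw [show a + 1 - 1 = (a - 1) + 1 by ring, Real.rpow_add_one hr.ne']
    push_cast
    simp only [id, Pi.neg_apply]
    ring

/-- The Gamma integral along a ray in the right half-plane. -/
theorem integral_rpow_mul_cexp {a : ℝ} (ha : 0 < a) {w : ℂ} (hw : 0 < w.re) :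
    ∫ r in Ioi (0 : ℝ), ((r ^ (a - 1) : ℝ) : ℂ) * Complex.exp (-(w * r)) =
      w ^ (-a : ℂ) * (Real.Gamma a : ℂ) := by
  have hopen : IsOpen {w : ℂ | 0 < w.re} := isOpen_lt continuous_const Complex.continuous_re
  have hdiff : DifferentiableOn ℂ (fun w : ℂ => w ^ (-a : ℂ) * (Real.Gamma a : ℂ))
      {w | 0 < w.re} := fun z hz =>
    ((differentiableAt_id.cpow_const (Or.inl hz)).mul_const _).differentiableWithinAt
  -- Identity theorem: both sides are analytic, and they agree at the reals `y > 1`, which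
  -- accumulate at `1`.
  refine AnalyticOnNhd.eqOn_of_preconnected_of_frequently_eq (z₀ := (1 : ℂ))
    ((differentiableOn_integral_rpow_mul_cexp ha).analyticOnNhd hopen)
    (hdiff.analyticOnNhd hopen) (convex_halfSpace_re_gt 0).isPreconnected (by simp) ?_ hw
  have htend : Tendsto (fun y : ℝ => (y : ℂ)) (𝓝[>] 1) (𝓝[≠] (1 : ℂ)) := by
    refine tendsto_nhdsWithin_iff.2 ⟨?_, ?_⟩
    · exact (Complex.continuous_ofReal.tendsto' 1 1 (by simp)).mono_left nhdsWithin_le_nhds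
    · filter_upwards [self_mem_nhdsWithin] with y (hy : 1 < y)
      simpa using hy.ne'
  refine htend.frequently (Eventually.frequently ?_)
  filter_upwards [self_mem_nhdsWithin] with y (hy : 1 < y)
  have hy0 : 0 < y := by linarith
  have h := Complex.integral_cpow_mul_exp_neg_mul_Ioi (a := (a : ℂ)) (by simpa using ha) hy0
  rw [Complex.Gamma_ofReal, one_div, Complex.inv_cpow _ _ (by
    rw [Complex.arg_ofReal_of_nonneg hy0.le]; exact Real.pi_pos.ne), ← Complex.cpow_neg] at h
  rw [← h]
  refine setIntegral_congr_fun measurableSet_Ioi fun r (hr : 0 < r) => ?_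
  rw [Complex.ofReal_cpow hr.le]
  push_cast
  rfl

/-! ### The stable density as an integral along a ray. -/

/-- As `μ < 1`, eventually `r^μ ≤ (c/2) r`, so half of the exponential decay survives. -/
lemma integrableOn_exp_neg_mul_add_rpow {μ c : ℝ} (hμ0 : 0 < μ) (hμ1 : μ < 1) (hc : 0 < c) :
    IntegrableOn (fun r : ℝ => Real.exp (-c * r + r ^ μ)) (Ioi 0) := by
  refine integrable_of_isBigO_exp_neg (b := c / 2) (by linarith) ?_ ?_
  · exact (Real.continuous_exp.comp ((continuous_const.mul continuous_id).add
      (Real.continuous_rpow_const hμ0.le))).continuousOn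
  · have h := tendsto_rpow_neg_atTop (y := 1 - μ) (by linarith)
    refine Asymptotics.IsBigO.of_bound 1 ?_
    filter_upwards [h.eventually (gt_mem_nhds (half_pos hc)), eventually_gt_atTop 0] with r h1 hr
    rw [Real.norm_of_nonneg (Real.exp_pos _).le, Real.norm_of_nonneg (Real.exp_pos _).le, one_mul,
      Real.exp_le_exp]
    have h2 : r ^ μ = r ^ (-(1 - μ)) * r := by
      rw [← Real.rpow_add_one hr.ne']; congr 1; ring
    rw [h2]
    nlinarith [mul_le_mul_of_nonneg_right h1.le hr.le]

/-- The integrand `exp (x σ - σ ^ μ) dσ` on the ray `σ = r e^{iφ}`. -/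
noncomputable def rayIntegrand (μ φ x r : ℝ) : ℂ :=
  Complex.exp (φ * Complex.I) * Complex.exp (-(-(x * Complex.exp (φ * Complex.I)) * r)) *
    Complex.exp (-(((r ^ μ : ℝ) : ℂ) * Complex.exp ((μ * φ : ℝ) * Complex.I)))

lemma norm_rayIntegrand (μ φ x r : ℝ) :
    ‖rayIntegrand μ φ x r‖ =
      Real.exp (x * Real.cos φ * r) * Real.exp (-(r ^ μ * Real.cos (μ * φ))) := by
  unfold rayIntegrand
  rw [norm_mul, norm_mul, Complex.norm_exp_ofReal_mul_I, Complex.norm_exp, Complex.norm_exp]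
  congr 2
  · rw [one_mul]
    congr 1
    simp [Complex.exp_ofReal_mul_I_re]
  · rw [Complex.neg_re, Complex.re_ofReal_mul, Complex.exp_ofReal_mul_I_re]

lemma re_neg_mul_exp_mul_I {x φ : ℝ} :
    (-((x : ℂ) * Complex.exp (φ * Complex.I))).re = -(x * Real.cos φ) := by
  rw [Complex.neg_re, Complex.re_ofReal_mul, Complex.exp_ofReal_mul_I_re]

/-- The minus sign moves the argument to `φ - π`, which lies in `(-π, 0]`, so the principal
logarithm selects it. -/
lemma neg_mul_exp_mul_I_cpow {x φ a : ℝ} (hx : 0 < x) (h0 : 0 < φ) (h1 : φ ≤ Real.pi) :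
    (-((x : ℂ) * Complex.exp (φ * Complex.I))) ^ (-a : ℂ) =
      ((x ^ (-a) : ℝ) : ℂ) * Complex.exp ((a * (Real.pi - φ) : ℝ) * Complex.I) := by
  have hpi := Real.pi_pos
  have h : -((x : ℂ) * Complex.exp (φ * Complex.I)) =
      Complex.exp ((Real.log x : ℝ) + ((φ - Real.pi : ℝ) : ℂ) * Complex.I) := by
    rw [Complex.exp_add, ← Complex.ofReal_exp, Real.exp_log hx, Complex.ofReal_sub, sub_mul,
      Complex.exp_sub, Complex.exp_pi_mul_I]
    ring
  rw [h, Complex.cpow_def_of_ne_zero (Complex.exp_ne_zero _), Complex.log_exp (by simp; linarith)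
    (by simp; linarith), Real.rpow_def_of_pos hx, Complex.ofReal_exp, ← Complex.exp_add]
  congr 1
  push_cast
  ring

/-- The angle cancels: the factor `σ^(mμ) dσ` has phase `φ(mμ+1)`, and the Gamma integral adds
`(mμ+1)(π-φ)`. -/
lemma stableDensity_term {μ φ x : ℝ} (hμ0 : 0 < μ) (hx : 0 < x)
    (hφ : Real.pi / 2 < φ) (hφ' : φ ≤ Real.pi) (m : ℕ) :
    ∫ r in Ioi (0 : ℝ), Complex.exp (φ * Complex.I) *
      Complex.exp (-(-(x * Complex.exp (φ * Complex.I)) * r)) *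
      ((m.factorial : ℂ)⁻¹ *
        (-(((r ^ μ : ℝ) : ℂ) * Complex.exp ((μ * φ : ℝ) * Complex.I))) ^ m) =
    (((-1 : ℝ) ^ m * x ^ (-(m * μ) - 1) * (Real.Gamma (m * μ + 1) / m.factorial) : ℝ) : ℂ) *
      Complex.exp (((m * μ + 1) * Real.pi : ℝ) * Complex.I) := by
  have hpi := Real.pi_pos
  have hcos : Real.cos φ < 0 := Real.cos_neg_of_pi_div_two_lt_of_lt hφ (by linarith)
  have hm : 0 < (m * μ + 1 : ℝ) := by positivity
  have key := integral_rpow_mul_cexp hm (w := -((x : ℂ) * Complex.exp (φ * Complex.I)))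
    (by rw [re_neg_mul_exp_mul_I]; nlinarith)
  rw [neg_mul_exp_mul_I_cpow hx (by linarith) hφ'] at key
  calc _ = ∫ r in Ioi (0 : ℝ), ((-1) ^ m * (m.factorial : ℂ)⁻¹ *
        Complex.exp ((φ * (m * μ + 1) : ℝ) * Complex.I)) *
        (((r ^ ((m * μ + 1 : ℝ) - 1) : ℝ) : ℂ) *
          Complex.exp (-(-(x * Complex.exp (φ * Complex.I)) * r))) := by
        refine setIntegral_congr_fun measurableSet_Ioi fun r (hr : 0 < r) => ?_
        have h1 : ((φ * (m * μ + 1) : ℝ) : ℂ) * Complex.I =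
            φ * Complex.I + m * ((μ * φ : ℝ) * Complex.I) := by push_cast; ring
        have h2 : r ^ ((m * μ + 1 : ℝ) - 1) = (r ^ μ) ^ m := by
          rw [← Real.rpow_natCast, ← Real.rpow_mul hr.le]; congr 1; ring
        simp only [h1, h2]
        rw [Complex.exp_add, Complex.exp_nat_mul, neg_pow, mul_pow]
        push_cast
        ring
    _ = _ := by
        rw [integral_const_mul, key]
        have h3 : ((m * μ + 1) * Real.pi : ℝ) * Complex.I = (φ * (m * μ + 1) : ℝ) * Complex.I +
            ((m * μ + 1) * (Real.pi - φ) : ℝ) * Complex.I := by push_cast; ring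
        rw [h3, Complex.exp_add, show -(m * μ + 1 : ℝ) = -(m * μ) - 1 by ring]
        push_cast
        ring

lemma measurable_rayIntegrand (μ φ x : ℝ) : Measurable (rayIntegrand μ φ x) := by
  unfold rayIntegrand; fun_prop

/-- Termwise integration of the exponential series of `-σ^μ`. The dominating sum is `exp(x r cos φ +
r^μ)`, integrable only because `cos φ < 0`; hence the strict inequality `π/2 < φ`. -/
lemma hasSum_integral_rayIntegrand {μ φ x : ℝ} (hμ0 : 0 < μ) (hμ1 : μ < 1) (hx : 0 < x)
    (hφ : Real.pi / 2 < φ) (hφ' : φ ≤ Real.pi) :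
    HasSum (fun m : ℕ =>
      (((-1 : ℝ) ^ m * x ^ (-(m * μ) - 1) * (Real.Gamma (m * μ + 1) / m.factorial) : ℝ) : ℂ) *
        Complex.exp (((m * μ + 1) * Real.pi : ℝ) * Complex.I))
      (∫ r in Ioi (0 : ℝ), rayIntegrand μ φ x r) := by
  have hpi := Real.pi_pos
  have hcos : Real.cos φ < 0 := Real.cos_neg_of_pi_div_two_lt_of_lt hφ (by linarith)
  simp_rw [← stableDensity_term hμ0 hx hφ hφ']
  have hsum (r : ℝ) : HasSum (fun m : ℕ => Real.exp (x * Real.cos φ * r) *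
      ((m.factorial : ℝ)⁻¹ * (r ^ μ) ^ m)) (Real.exp (x * Real.cos φ * r) * Real.exp (r ^ μ)) := by
    have := NormedSpace.exp_series_hasSum_exp' (𝕂 := ℝ) (r ^ μ)
    rw [← Real.exp_eq_exp_ℝ] at this
    simpa using this.mul_left (Real.exp (x * Real.cos φ * r))
  refine hasSum_integral_of_dominated_convergence
    (fun m r => Real.exp (x * Real.cos φ * r) * ((m.factorial : ℝ)⁻¹ * (r ^ μ) ^ m)) ?_ ?_ ?_ ?_ ?_
  · intro m
    exact Measurable.aestronglyMeasurable (by fun_prop)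
  · intro m
    filter_upwards [ae_restrict_mem measurableSet_Ioi] with r (hr : 0 < r)
    refine le_of_eq ?_
    rw [norm_mul, norm_mul, Complex.norm_exp_ofReal_mul_I, one_mul, Complex.norm_exp, norm_mul,
      norm_pow, norm_neg, norm_mul, Complex.norm_exp_ofReal_mul_I, mul_one, Complex.norm_real,
      Real.norm_of_nonneg (by positivity), norm_inv, Complex.norm_natCast]
    congr 2
    rw [← neg_mul, neg_neg, Complex.re_mul_ofReal, Complex.re_ofReal_mul,
      Complex.exp_ofReal_mul_I_re]
  · exact Eventually.of_forall fun r => (hsum r).summable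
  · simp_rw [fun r => (hsum r).tsum_eq, ← Real.exp_add]
    have := integrableOn_exp_neg_mul_add_rpow (c := -(x * Real.cos φ)) hμ0 hμ1 (by nlinarith)
    simpa [IntegrableOn] using this
  · refine Eventually.of_forall fun r => ?_
    have := NormedSpace.exp_series_hasSum_exp' (𝕂 := ℂ)
      (-(((r ^ μ : ℝ) : ℂ) * Complex.exp ((μ * φ : ℝ) * Complex.I)))
    rw [← Complex.exp_eq_exp_ℂ] at this
    simpa [rayIntegrand] using this.mul_left (Complex.exp (φ * Complex.I) *
      Complex.exp (-(-(x * Complex.exp (φ * Complex.I)) * r)))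

theorem stableDensity_eq_integral_ray {μ φ x : ℝ} (hμ0 : 0 < μ) (hμ1 : μ < 1) (hx : 0 < x)
    (hφ : Real.pi / 2 < φ) (hφ' : φ ≤ Real.pi) :
    stableDensity μ x = (1 / Real.pi) * (∫ r in Ioi (0 : ℝ), rayIntegrand μ φ x r).im := by
  have h := (Complex.hasSum_im (hasSum_integral_rayIntegrand hμ0 hμ1 hx hφ hφ'))
  simp only [Complex.im_ofReal_mul, Complex.exp_ofReal_mul_I_im] at h
  -- The term `m = 0` is a multiple of `sin π = 0`; removing it gives the index shift in
  -- `stableDensity`.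
  rw [← hasSum_nat_add_iff' 1] at h
  unfold stableDensity
  congr 1
  refine HasSum.tsum_eq ?_
  simp only [Finset.range_one, Finset.sum_singleton, Nat.cast_zero, zero_mul, zero_add, one_mul,
    Real.sin_pi, mul_zero, sub_zero] at h
  refine h.congr_fun fun m => ?_
  rw [add_mul _ 1, one_mul Real.pi, Real.sin_add_pi, pow_succ, neg_mul _ μ,
    show ((m + 1 : ℕ) : ℝ) * μ * Real.pi = ((m + 1 : ℕ) : ℝ) * Real.pi * μ by ring]
  ring

/-- At the angle `π / (1 + μ)` both `exp(xσ)` and `exp(-σ^μ)` decay along the ray. -/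
lemma rayAngle_bounds {μ : ℝ} (hμ0 : 0 < μ) (hμ1 : μ < 1) :
    Real.pi / 2 < Real.pi / (1 + μ) ∧ Real.pi / (1 + μ) < Real.pi ∧
      μ * (Real.pi / (1 + μ)) < Real.pi / 2 := by
  have hpi := Real.pi_pos
  refine ⟨?_, ?_, ?_⟩
  · gcongr; linarith
  · rw [div_lt_iff₀ (by linarith)]; nlinarith
  · rw [← mul_div_assoc, div_lt_div_iff₀ (by linarith) (by norm_num)]; nlinarith

lemma norm_rayIntegrand_le {μ φ x r c : ℝ} (hx : 0 < x) (hr : 0 < r) (hφ : Real.cos φ ≤ 0)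
    (hc : c ≤ Real.cos (μ * φ)) : ‖rayIntegrand μ φ x r‖ ≤ Real.exp (-c * r ^ μ) := by
  rw [norm_rayIntegrand, ← Real.exp_add, Real.exp_le_exp]
  have h1 : 0 < r ^ μ := by positivity
  nlinarith [mul_nonneg (mul_pos hx hr).le (neg_nonneg.2 hφ)]

lemma integrableOn_exp_neg_mul_rpow {μ c : ℝ} (hμ0 : 0 < μ) (hc : 0 < c) :
    IntegrableOn (fun r : ℝ => Real.exp (-c * r ^ μ)) (Ioi 0) := by
  simpa using integrableOn_rpow_mul_exp_neg_mul_rpow (s := 0) (by norm_num) hμ0 hc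

/-- The stable density as an integral along the imaginary axis. -/
theorem stableDensity_eq_integral_imaginary_ray {μ x : ℝ} (hμ0 : 0 < μ) (hμ1 : μ < 1)
    (hx : 0 < x) :
    stableDensity μ x =
      (1 / Real.pi) * (∫ r in Ioi (0 : ℝ), rayIntegrand μ (Real.pi / 2) x r).im := by
  have hpi := Real.pi_pos
  obtain ⟨h1, h2, h3⟩ := rayAngle_bounds hμ0 hμ1
  set φ₀ := Real.pi / (1 + μ)
  have hc : 0 < Real.cos (μ * φ₀) := Real.cos_pos_of_mem_Ioo ⟨by nlinarith, h3⟩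
  have hI : ∀ᶠ φ in 𝓝[>] (Real.pi / 2), φ ∈ Ioo (Real.pi / 2) φ₀ := Ioo_mem_nhdsGT h1
  -- At `φ = π/2` the factor `exp(xσ)` no longer decays. For angles in `(π/2, φ₀)` the factor
  -- `exp(-σ^μ)` decays at least at the rate `cos(μφ₀)`, which gives a common majorant for the
  -- limit.
  have htend : Tendsto (fun φ => ∫ r in Ioi (0 : ℝ), rayIntegrand μ φ x r) (𝓝[>] (Real.pi / 2))
      (𝓝 (∫ r in Ioi (0 : ℝ), rayIntegrand μ (Real.pi / 2) x r)) := by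
    refine tendsto_integral_filter_of_dominated_convergence
      (fun r => Real.exp (-Real.cos (μ * φ₀) * r ^ μ)) ?_ ?_ (integrableOn_exp_neg_mul_rpow hμ0 hc)
      ?_
    · exact Eventually.of_forall fun φ => (measurable_rayIntegrand μ φ x).aestronglyMeasurable
    · filter_upwards [hI] with φ hφ
      filter_upwards [ae_restrict_mem measurableSet_Ioi] with r hr
      refine norm_rayIntegrand_le hx hr
        (Real.cos_neg_of_pi_div_two_lt_of_lt hφ.1 (by linarith [hφ.2])).le ?_
      refine Real.cos_le_cos_of_nonneg_of_le_pi (by nlinarith [hφ.1]) (by linarith) ?_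
      exact mul_le_mul_of_nonneg_left hφ.2.le hμ0.le
    · refine Eventually.of_forall fun r => ?_
      have : Continuous fun φ => rayIntegrand μ φ x r := by unfold rayIntegrand; fun_prop
      exact (this.tendsto _).mono_left nhdsWithin_le_nhds
  refine tendsto_nhds_unique (tendsto_const_nhds (f := 𝓝[>] (Real.pi / 2)))
    (((Complex.continuous_im.tendsto _).comp htend).const_mul (1 / Real.pi) |>.congr' ?_)
  filter_upwards [hI] with φ hφ
  exact (stableDensity_eq_integral_ray hμ0 hμ1 hx hφ.1 (by linarith [hφ.2])).symm

/-! ### The moment of order `-μ` of the stable density. -/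

lemma integral_rpow_mul_cexp_neg_rpow {μ φ : ℝ} (hμ0 : 0 < μ) (hc : 0 < Real.cos (μ * φ)) :
    ∫ r in Ioi (0 : ℝ), ((r ^ (μ - 1) : ℝ) : ℂ) *
      Complex.exp (-(((r ^ μ : ℝ) : ℂ) * Complex.exp ((μ * φ : ℝ) * Complex.I))) =
      (μ : ℂ)⁻¹ * Complex.exp (-((μ * φ : ℝ) * Complex.I)) := by
  set w := Complex.exp ((μ * φ : ℝ) * Complex.I) with hw
  have hwre : w.re = Real.cos (μ * φ) := Complex.exp_ofReal_mul_I_re _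
  have hnorm (r : ℝ) : ‖Complex.exp (-(((r ^ μ : ℝ) : ℂ) * w))‖ =
      Real.exp (-Real.cos (μ * φ) * r ^ μ) := by
    rw [Complex.norm_exp, Complex.neg_re, Complex.re_ofReal_mul, hwre]
    congr 1; ring
  have h := integral_Ioi_of_hasDerivAt_of_tendsto (a := 0) (m := 0)
    (f := fun r : ℝ => -((μ : ℂ)⁻¹ * w⁻¹ * Complex.exp (-(((r ^ μ : ℝ) : ℂ) * w))))
    (f' := fun r : ℝ => ((r ^ (μ - 1) : ℝ) : ℂ) * Complex.exp (-(((r ^ μ : ℝ) : ℂ) * w)))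
    ?_ ?_ ?_ ?_
  · rw [h, Complex.exp_neg ((μ * φ : ℝ) * Complex.I), ← hw]
    simp [hμ0.ne']
  · have : Continuous fun r : ℝ => r ^ μ := Real.continuous_rpow_const hμ0.le
    have : Continuous
      (fun r : ℝ => -((μ : ℂ)⁻¹ * w⁻¹ * Complex.exp (-(((r ^ μ : ℝ) : ℂ) * w)))) := by fun_prop
    exact this.continuousWithinAt
  · intro r (hr : 0 < r)
    have h1 := (Real.hasDerivAt_rpow_const (p := μ) (Or.inl hr.ne')).ofReal_comp
    have h2 := ((h1.mul_const w).fun_neg.cexp.const_mul ((μ : ℂ)⁻¹ * w⁻¹)).fun_neg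
    convert! h2 using 1
    have : (μ : ℂ) ≠ 0 := by exact_mod_cast hμ0.ne'
    have hw0 : w ≠ 0 := Complex.exp_ne_zero _
    push_cast
    field_simp
  · refine Integrable.mono' (integrableOn_rpow_mul_exp_neg_mul_rpow (s := μ - 1) (by linarith)
      hμ0 hc) (Measurable.aestronglyMeasurable (by fun_prop)) ?_
    filter_upwards [ae_restrict_mem measurableSet_Ioi] with r (hr : 0 < r)
    rw [norm_mul, hnorm, Complex.norm_real, Real.norm_of_nonneg (by positivity)]
  · have h0 : Tendsto (fun r : ℝ => Complex.exp (-(((r ^ μ : ℝ) : ℂ) * w))) atTop (𝓝 0) := by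
      rw [tendsto_zero_iff_norm_tendsto_zero]
      simp_rw [hnorm]
      exact Real.tendsto_exp_atBot.comp
        ((tendsto_rpow_atTop hμ0).const_mul_atTop_of_neg (by linarith))
    simpa using (h0.const_mul ((μ : ℂ)⁻¹ * w⁻¹)).neg

/-- Justifies Fubini: integrating the norm in `x` first leaves a multiple of `r^(μ-1) exp(-cos(μφ)
r^μ)`. The two integrations use the two cosine conditions in turn. -/
lemma integrable_rpow_mul_rayIntegrand {μ φ : ℝ} (hμ0 : 0 < μ) (hμ1 : μ < 1)
    (hφ : Real.cos φ < 0) (hc : 0 < Real.cos (μ * φ)) :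
    Integrable (Function.uncurry fun x r : ℝ => ((x ^ (-μ) : ℝ) : ℂ) * rayIntegrand μ φ x r)
      ((volume.restrict (Ioi 0)).prod (volume.restrict (Ioi 0))) := by
  have hmeas : Measurable
      (Function.uncurry fun x r : ℝ => ((x ^ (-μ) : ℝ) : ℂ) * rayIntegrand μ φ x r) := by
    unfold rayIntegrand Function.uncurry; fun_prop
  have hnorm {x r : ℝ} (hx : 0 < x) : ‖((x ^ (-μ) : ℝ) : ℂ) * rayIntegrand μ φ x r‖ =
      Real.exp (-Real.cos (μ * φ) * r ^ μ) *
        (x ^ ((1 - μ) - 1) * Real.exp (-(-Real.cos φ * r * x))) := by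
    rw [norm_mul, norm_rayIntegrand, Complex.norm_real, Real.norm_of_nonneg (by positivity)]
    rw [show (1 - μ) - 1 = -μ by ring, show -(-Real.cos φ * r * x) = x * Real.cos φ * r by ring,
      show -Real.cos (μ * φ) * r ^ μ = -(r ^ μ * Real.cos (μ * φ)) by ring]
    ring
  refine (integrable_prod_iff' hmeas.aestronglyMeasurable).2 ⟨?_, ?_⟩
  · filter_upwards [ae_restrict_mem measurableSet_Ioi] with r (hr : 0 < r)
    have hcr : 0 < -Real.cos φ * r := by nlinarith
    refine Integrable.mono' (g := fun x => Real.exp (-Real.cos (μ * φ) * r ^ μ) *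
        (x ^ ((1 - μ) - 1) * Real.exp (-(-Real.cos φ * r * x)))) ?_
      (hmeas.comp measurable_prodMk_right).aestronglyMeasurable ?_
    · refine Integrable.const_mul ?_ _
      simpa [neg_mul, IntegrableOn] using integrableOn_rpow_mul_exp_neg_mul (a := 1 - μ) (by linarith) hcr
    · filter_upwards [ae_restrict_mem measurableSet_Ioi] with x (hx : 0 < x)
      exact (hnorm hx).le
  · have hint : IntegrableOn (fun r : ℝ => (r ^ (μ - 1) * Real.exp (-Real.cos (μ * φ) * r ^ μ)) *
        ((1 / (-Real.cos φ)) ^ (1 - μ) * Real.Gamma (1 - μ))) (Ioi 0) :=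
      (integrableOn_rpow_mul_exp_neg_mul_rpow (s := μ - 1) (by linarith) hμ0 hc).mul_const _
    refine hint.congr_fun (fun r (hr : 0 < r) => ?_) measurableSet_Ioi
    have hcr : 0 < -Real.cos φ * r := by nlinarith
    simp only [Function.uncurry]
    rw [setIntegral_congr_fun measurableSet_Ioi fun x (hx : 0 < x) => hnorm hx,
      integral_const_mul, Real.integral_rpow_mul_exp_neg_mul_Ioi (by linarith) hcr, one_div, one_div,
      mul_inv, Real.mul_rpow (inv_nonneg.2 (by linarith)) (inv_nonneg.2 hr.le),
      Real.inv_rpow hr.le, ← Real.rpow_neg hr.le]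
    rw [show -(1 - μ) = μ - 1 by ring]
    ring

/-- This is the Gamma integral of exponent `1 - μ`, with `r` now in the role of the parameter. -/
lemma integral_rpow_mul_rayIntegrand {μ φ r : ℝ} (hμ1 : μ < 1) (hr : 0 < r)
    (hφ : Real.pi / 2 < φ) (hφ' : φ ≤ Real.pi) :
    ∫ x in Ioi (0 : ℝ), ((x ^ (-μ) : ℝ) : ℂ) * rayIntegrand μ φ x r =
      (Real.Gamma (1 - μ) : ℂ) *
        Complex.exp ((φ + (1 - μ) * (Real.pi - φ) : ℝ) * Complex.I) *
        (((r ^ (μ - 1) : ℝ) : ℂ) *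
          Complex.exp (-(((r ^ μ : ℝ) : ℂ) * Complex.exp ((μ * φ : ℝ) * Complex.I)))) := by
  have hpi := Real.pi_pos
  have hcos : Real.cos φ < 0 := Real.cos_neg_of_pi_div_two_lt_of_lt hφ (by linarith)
  have key := integral_rpow_mul_cexp (a := 1 - μ) (by linarith)
    (w := -((r : ℂ) * Complex.exp (φ * Complex.I))) (by rw [re_neg_mul_exp_mul_I]; nlinarith)
  rw [neg_mul_exp_mul_I_cpow hr (by linarith) hφ'] at key
  calc _ = ∫ x in Ioi (0 : ℝ), (Complex.exp (φ * Complex.I) *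
        Complex.exp (-(((r ^ μ : ℝ) : ℂ) * Complex.exp ((μ * φ : ℝ) * Complex.I)))) *
        (((x ^ ((1 - μ) - 1) : ℝ) : ℂ) *
          Complex.exp (-(-(r * Complex.exp (φ * Complex.I)) * x))) := by
        congr 1
        ext x
        unfold rayIntegrand
        rw [show -(-((x : ℂ) * Complex.exp (φ * Complex.I)) * r) =
          -(-(r * Complex.exp (φ * Complex.I)) * x) by ring, show (1 - μ) - 1 = -μ by ring]
        ring
    _ = _ := by
        rw [integral_const_mul, key, show -(1 - μ) = μ - 1 by ring, Complex.ofReal_add, add_mul,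
          Complex.exp_add]
        ring

/-- Integrability of `x ^ (-μ)` against the stable density, and the value of the integral. -/
theorem integral_rpow_mul_stableDensity {μ : ℝ} (hμ0 : 0 < μ) (hμ1 : μ < 1) :
    IntegrableOn (fun x : ℝ => x ^ (-μ) * stableDensity μ x) (Ioi 0) ∧
      ∫ x in Ioi (0 : ℝ), x ^ (-μ) * stableDensity μ x = 1 / (μ * Real.Gamma μ) := by
  have hpi := Real.pi_pos
  obtain ⟨h1, h2, h3⟩ := rayAngle_bounds hμ0 hμ1
  set φ := Real.pi / (1 + μ)
  have hc : 0 < Real.cos (μ * φ) := Real.cos_pos_of_mem_Ioo ⟨by nlinarith, h3⟩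
  have hcos : Real.cos φ < 0 := Real.cos_neg_of_pi_div_two_lt_of_lt h1 (by linarith)
  have hint := integrable_rpow_mul_rayIntegrand hμ0 hμ1 hcos hc
  have hleft := hint.integral_prod_left
  simp only [Function.uncurry, integral_const_mul] at hleft
  have heq : EqOn (fun x : ℝ => (1 / Real.pi) * (((x ^ (-μ) : ℝ) : ℂ) *
      ∫ r in Ioi (0 : ℝ), rayIntegrand μ φ x r).im)
      (fun x : ℝ => x ^ (-μ) * stableDensity μ x) (Ioi 0) := fun x hx => by
    simp only
    rw [stableDensity_eq_integral_ray hμ0 hμ1 hx h1 h2.le, Complex.im_ofReal_mul]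
    ring
  refine ⟨IntegrableOn.congr_fun (hleft.im.const_mul _) heq measurableSet_Ioi, ?_⟩
  rw [← setIntegral_congr_fun measurableSet_Ioi heq, integral_const_mul]
  have him := Complex.imCLM.integral_comp_comm hleft
  simp only [Complex.imCLM_apply] at him
  rw [him]
  have hswap := integral_integral_swap hint
  simp only [integral_const_mul] at hswap
  rw [hswap, setIntegral_congr_fun measurableSet_Ioi fun r hr =>
    integral_rpow_mul_rayIntegrand hμ1 hr h1 h2.le, integral_const_mul,
    integral_rpow_mul_cexp_neg_rpow hμ0 hc]
  -- The phases add up to `π - πμ`, independent of `φ`; the reflection formula then cancels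
  -- `sin(πμ)` against `Γ(1-μ)`.
  have hexp : (Real.Gamma (1 - μ) : ℂ) *
        Complex.exp ((φ + (1 - μ) * (Real.pi - φ) : ℝ) * Complex.I) *
        ((μ : ℂ)⁻¹ * Complex.exp (-((μ * φ : ℝ) * Complex.I))) =
      ((Real.Gamma (1 - μ) * μ⁻¹ : ℝ) : ℂ) *
        Complex.exp ((Real.pi - Real.pi * μ : ℝ) * Complex.I) := by
    rw [show ((Real.pi - Real.pi * μ : ℝ) : ℂ) * Complex.I =
      (φ + (1 - μ) * (Real.pi - φ) : ℝ) * Complex.I + -((μ * φ : ℝ) * Complex.I) by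
        push_cast; ring, Complex.exp_add]
    push_cast
    ring
  rw [hexp, Complex.im_ofReal_mul, Complex.exp_ofReal_mul_I_im, Real.sin_pi_sub]
  have hrefl := Real.Gamma_mul_Gamma_one_sub μ
  have hG : 0 < Real.Gamma μ := Real.Gamma_pos_of_pos hμ0
  have hs : 0 < Real.sin (Real.pi * μ) :=
    Real.sin_pos_of_pos_of_lt_pi (by positivity) (by nlinarith)
  rw [eq_div_iff hs.ne'] at hrefl
  field_simp
  linarith

/-! ### Nonnegativity of the stable density. -/

/-- `F` is the sum on the unit disc of a power series with nonnegative coefficients. -/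
def HasNonnegCoeffs (F : ℂ → ℂ) : Prop :=
  ∃ b : ℕ → ℝ, (∀ k, 0 ≤ b k) ∧ ∀ z : ℂ, ‖z‖ < 1 → HasSum (fun k => (b k : ℂ) * z ^ k) (F z)

lemma HasNonnegCoeffs.one : HasNonnegCoeffs fun _ => 1 := by
  refine ⟨fun k => if k = 0 then 1 else 0, fun k => by positivity, fun z _ => ?_⟩
  convert! hasSum_ite_eq (0 : ℕ) (1 : ℂ) using 1
  ext k
  by_cases hk : k = 0 <;> simp [hk]

lemma HasNonnegCoeffs.mul {F G : ℂ → ℂ} (hF : HasNonnegCoeffs F) (hG : HasNonnegCoeffs G) :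
    HasNonnegCoeffs fun z => F z * G z := by
  obtain ⟨b, hb, hbF⟩ := hF
  obtain ⟨c, hc, hcG⟩ := hG
  refine ⟨fun k => ∑ q ∈ Finset.HasAntidiagonal.antidiagonal k, b q.1 * c q.2,
    fun k => Finset.sum_nonneg fun q _ => mul_nonneg (hb _) (hc _), fun z hz => ?_⟩
  have h1 := (hbF z hz).summable.norm
  have h2 := (hcG z hz).summable.norm
  have h := (summable_norm_sum_mul_antidiagonal_of_summable_norm h1 h2).of_norm.hasSum
  rw [← tsum_mul_tsum_eq_tsum_sum_antidiagonal_of_summable_norm h1 h2, (hbF z hz).tsum_eq,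
    (hcG z hz).tsum_eq] at h
  convert! h using 1
  ext k
  rw [Complex.ofReal_sum, Finset.sum_mul]
  refine Finset.sum_congr rfl fun q hq => ?_
  rw [← Finset.HasAntidiagonal.mem_antidiagonal.1 hq, pow_add]
  push_cast
  ring

lemma HasNonnegCoeffs.pow {F : ℂ → ℂ} (hF : HasNonnegCoeffs F) (n : ℕ) :
    HasNonnegCoeffs fun z => F z ^ n := by
  induction n with
  | zero => simpa using HasNonnegCoeffs.one
  | succ n ih => simpa [pow_succ] using ih.mul hF

/-- The triangle inequality is an equality on the nonnegative axis. -/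
lemma HasNonnegCoeffs.norm_le {F : ℂ → ℂ} (hF : HasNonnegCoeffs F) {z : ℂ} (hz : ‖z‖ < 1) :
    ‖F z‖ ≤ ‖F ‖z‖‖ := by
  obtain ⟨b, hb, hbF⟩ := hF
  have h := hbF ‖z‖ (by simpa using hz)
  have h' : HasSum (fun k => b k * ‖z‖ ^ k) (F ‖z‖).re := by
    have := Complex.hasSum_re h
    exact_mod_cast this
  refine le_trans ?_ (Complex.re_le_norm _)
  refine (hbF z hz).norm_le_of_bounded h' fun k => ?_
  rw [norm_mul, norm_pow, Complex.norm_real, Real.norm_of_nonneg (hb k)]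

/-- Passing from the binomial coefficient of index `k+1` to the next multiplies it by
`(μ-(k+1))/(k+2) < 0`, so the signs alternate from `μ > 0` on. -/
lemma choose_sign {μ : ℝ} (hμ0 : 0 < μ) (hμ1 : μ < 1) (k : ℕ) :
    0 ≤ (-1) ^ k * Ring.choose μ (k + 1) := by
  induction k with
  | zero => simpa using hμ0.le
  | succ k ih =>
    have h := Ring.choose_smul_choose μ (n := k + 1 + 1) (k := k + 1) (by omega)
    rw [show k + 1 + 1 - (k + 1) = 1 by omega, Ring.choose_one_right, Nat.choose_succ_self_right,
      nsmul_eq_mul] at h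
    have h2 : ((k + 1 + 1 : ℕ) : ℝ) * ((-1) ^ (k + 1) * Ring.choose μ (k + 1 + 1)) =
        ((-1) ^ k * Ring.choose μ (k + 1)) * ((k + 1 : ℕ) - μ) := by
      rw [mul_left_comm, h, pow_succ]; ring
    have h3 : 0 ≤ ((k + 1 : ℕ) : ℝ) - μ := by push_cast; linarith [(k.cast_nonneg : (0 : ℝ) ≤ k)]
    have h4 : (0 : ℝ) < ((k + 1 + 1 : ℕ) : ℝ) := by positivity
    exact nonneg_of_mul_nonneg_right (h2 ▸ mul_nonneg ih h3) h4

lemma hasNonnegCoeffs_one_sub_cpow {μ : ℝ} (hμ0 : 0 < μ) (hμ1 : μ < 1) :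
    HasNonnegCoeffs fun z => 1 - (1 - z) ^ (μ : ℂ) := by
  refine ⟨fun k => if k = 0 then 0 else -((-1) ^ k * Ring.choose μ k), fun k => ?_, fun z hz => ?_⟩
  · rcases k with _ | k
    · simp
    · simpa [pow_succ] using choose_sign hμ0 hμ1 k
  · have h := (Complex.one_add_cpow_hasFPowerSeriesOnBall_zero (a := (μ : ℂ))).hasSum
      (y := -z) (by simpa [Metric.eball, enorm_eq_nnnorm, ← NNReal.coe_lt_coe] using hz)
    have h1 := (hasSum_ite_eq (0 : ℕ) (1 : ℂ)).sub h
    convert! h1 using 1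
    · ext k
      rw [binomialSeries_apply]
      rcases k with _ | k
      · simp
      · simp only [← Complex.ofReal_choose, List.ofFn_const, List.prod_replicate, smul_eq_mul,
          Nat.add_eq_zero_iff, one_ne_zero, and_false, if_false]
        rw [neg_pow z]
        push_cast
        ring
    · simp [sub_eq_add_neg]

/-- By `HasNonnegCoeffs.norm_le` it is enough to look at `|z|`, where `1 - (1-|z|)^μ` lies in
`[0,1]`. The bound is uniform in `n`, as dominated convergence requires. -/
lemma norm_one_sub_cpow_pow_le {μ : ℝ} (hμ0 : 0 < μ) (hμ1 : μ < 1) {z : ℂ} (hz : ‖z‖ < 1)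
    (n : ℕ) : ‖(1 - (1 - z) ^ (μ : ℂ)) ^ n‖ ≤ 1 := by
  rw [norm_pow]
  refine pow_le_one₀ (norm_nonneg _) (((hasNonnegCoeffs_one_sub_cpow hμ0 hμ1).norm_le hz).trans ?_)
  have h0 : 0 ≤ 1 - ‖z‖ := by linarith
  have h1 : 0 ≤ (1 - ‖z‖) ^ μ := Real.rpow_nonneg h0 _
  have h2 : (1 - ‖z‖) ^ μ ≤ 1 := Real.rpow_le_one h0 (by linarith [norm_nonneg z]) hμ0.le
  have h3 : (1 : ℂ) - (1 - (‖z‖ : ℂ)) ^ (μ : ℂ) = ((1 - (1 - ‖z‖) ^ μ : ℝ) : ℂ) := by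
    rw [Complex.ofReal_sub, Complex.ofReal_cpow h0]
    push_cast
    rfl
  rw [h3, Complex.norm_real, Real.norm_of_nonneg (by linarith)]
  linarith

/-- Twice this integral is the Fourier transform of a Gaussian, again a positive Gaussian. -/
lemma integral_cos_mul_gaussian_nonneg {ε : ℝ} (hε : 0 < ε) (y : ℝ) :
    0 ≤ ∫ r in Ioi (0 : ℝ), Real.cos (y * r) * Real.exp (-ε * r ^ 2) := by
  have h1 := integral_comp_abs (f := fun r : ℝ => Real.cos (y * r) * Real.exp (-ε * r ^ 2))
  have h2 := fourierIntegral_gaussian (b := (ε : ℂ)) (by simpa using hε) (y : ℂ)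
  have hint : Integrable fun r : ℝ =>
      Complex.exp (Complex.I * y * r) * Complex.exp (-(ε : ℂ) * (r : ℂ) ^ 2) := by
    refine Integrable.mono' (integrable_exp_neg_mul_sq hε)
      (Continuous.aestronglyMeasurable (by fun_prop)) (Eventually.of_forall fun r => ?_)
    rw [norm_mul, show Complex.I * y * r = ((y * r : ℝ) : ℂ) * Complex.I by push_cast; ring,
      Complex.norm_exp_ofReal_mul_I, one_mul, Complex.norm_exp]
    simp [← Complex.ofReal_pow]
  have h3 := Complex.reCLM.integral_comp_comm hint
  have h4 : ∀ r : ℝ, Complex.reCLM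
      (Complex.exp (Complex.I * y * r) * Complex.exp (-(ε : ℂ) * (r : ℂ) ^ 2)) =
      Real.cos (y * r) * Real.exp (-ε * r ^ 2) := fun r => by
    rw [show Complex.I * y * r = ((y * r : ℝ) : ℂ) * Complex.I by push_cast; ring,
      show -(ε : ℂ) * (r : ℂ) ^ 2 = ((-ε * r ^ 2 : ℝ) : ℂ) by push_cast; ring, ← Complex.ofReal_exp,
      Complex.reCLM_apply, Complex.re_mul_ofReal, Complex.exp_ofReal_mul_I_re]
  have h5 : ∀ r : ℝ, Real.cos (y * |r|) * Real.exp (-ε * |r| ^ 2) =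
      Real.cos (y * r) * Real.exp (-ε * r ^ 2) := fun r => by
    rw [sq_abs]
    congr 1
    rcases abs_choice r with h | h <;> simp [h]
  have h6 : ((Real.pi : ℂ) / ε) ^ (1 / 2 : ℂ) * Complex.exp (-(y : ℂ) ^ 2 / (4 * ε)) =
      (((Real.pi / ε) ^ (1 / 2 : ℝ) * Real.exp (-y ^ 2 / (4 * ε)) : ℝ) : ℂ) := by
    rw [Complex.ofReal_mul, Complex.ofReal_cpow (by positivity [Real.pi_pos])]
    push_cast
    rfl
  simp only [h4] at h3
  rw [h2, h6, Complex.reCLM_apply, Complex.ofReal_re] at h3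
  simp only [h5, h3] at h1
  have : 0 ≤ (Real.pi / ε) ^ (1 / 2 : ℝ) * Real.exp (-y ^ 2 / (4 * ε)) := by
    have := Real.pi_pos; positivity
  linarith

/-- The `k`-th Taylor term of `F` has weight `b_k exp(-δhk) ≥ 0` and frequency `x - kh`, so its real
part is a Gaussian cosine integral. Here `δ > 0` keeps the argument inside the unit disc. -/
lemma integral_lattice_nonneg {F : ℂ → ℂ} (hF : HasNonnegCoeffs F) {ε δ h : ℝ} (hε : 0 < ε)
    (hδ : 0 < δ) (hh : 0 < h) (x : ℝ) :
    0 ≤ (∫ r in Ioi (0 : ℝ), Complex.exp ((x * r : ℝ) * Complex.I) * (Real.exp (-ε * r ^ 2) : ℝ) *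
      F (Complex.exp (-((δ + r * Complex.I) * h)))).re := by
  obtain ⟨b, hb, hbF⟩ := hF
  have hnorm (r : ℝ) : ‖Complex.exp (-((δ + r * Complex.I) * h))‖ = Real.exp (-(δ * h)) := by
    rw [Complex.norm_exp]; simp
  have hlt : Real.exp (-(δ * h)) < 1 := by
    rw [Real.exp_lt_one_iff]; nlinarith
  have hsb : Summable fun k => b k * Real.exp (-(δ * h)) ^ k := by
    have := (hbF (Real.exp (-(δ * h)) : ℝ)
      (by rwa [Complex.norm_real, Real.norm_of_nonneg (Real.exp_pos _).le])).summable
    exact_mod_cast this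
  have hG : IntegrableOn (fun r : ℝ => Real.exp (-ε * r ^ 2)) (Ioi 0) :=
    (integrable_exp_neg_mul_sq hε).integrableOn
  have hsum := hasSum_integral_of_dominated_convergence (μ := volume.restrict (Ioi (0 : ℝ)))
    (F := fun (k : ℕ) (r : ℝ) =>
      Complex.exp ((x * r : ℝ) * Complex.I) * (Real.exp (-ε * r ^ 2) : ℝ) *
        ((b k : ℂ) * Complex.exp (-((δ + r * Complex.I) * h)) ^ k))
    (f := fun r => Complex.exp ((x * r : ℝ) * Complex.I) * (Real.exp (-ε * r ^ 2) : ℝ) *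
      F (Complex.exp (-((δ + r * Complex.I) * h))))
    (fun k r => Real.exp (-ε * r ^ 2) * (b k * Real.exp (-(δ * h)) ^ k))
    (fun k => Continuous.aestronglyMeasurable (by fun_prop))
    (fun k => Eventually.of_forall fun r => ?_)
    (Eventually.of_forall fun r => hsb.mul_left _)
    (by simp_rw [tsum_mul_left]; exact hG.mul_const _)
    (Eventually.of_forall fun r => (hbF _ ((hnorm r).trans_lt hlt)).mul_left _)
  · refine HasSum.nonneg (fun k => ?_) (Complex.hasSum_re hsum)
    have hint : Integrable (fun r : ℝ => Complex.exp ((x * r : ℝ) * Complex.I) *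
        (Real.exp (-ε * r ^ 2) : ℝ) * ((b k : ℂ) * Complex.exp (-((δ + r * Complex.I) * h)) ^ k))
        (volume.restrict (Ioi 0)) := by
      refine Integrable.mono' (hG.mul_const (b k * Real.exp (-(δ * h)) ^ k))
        (Continuous.aestronglyMeasurable (by fun_prop)) (Eventually.of_forall fun r => ?_)
      rw [norm_mul, norm_mul, Complex.norm_exp_ofReal_mul_I, one_mul, Complex.norm_real,
        Real.norm_of_nonneg (Real.exp_pos _).le, norm_mul, norm_pow, hnorm, Complex.norm_real,
        Real.norm_of_nonneg (hb k)]
    have hre := Complex.reCLM.integral_comp_comm hint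
    rw [Complex.reCLM_apply] at hre
    rw [← hre]
    have hterm (r : ℝ) : Complex.reCLM (Complex.exp ((x * r : ℝ) * Complex.I) *
        (Real.exp (-ε * r ^ 2) : ℝ) * ((b k : ℂ) * Complex.exp (-((δ + r * Complex.I) * h)) ^ k)) =
        (b k * Real.exp (-(δ * h) * k)) *
          (Real.cos ((x - k * h) * r) * Real.exp (-ε * r ^ 2)) := by
      have : Complex.exp ((x * r : ℝ) * Complex.I) *
        (Real.exp (-ε * r ^ 2) : ℝ) * ((b k : ℂ) * Complex.exp (-((δ + r * Complex.I) * h)) ^ k) =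
        ((b k * Real.exp (-(δ * h) * k) * Real.exp (-ε * r ^ 2) : ℝ) : ℂ) *
          Complex.exp (((x - k * h) * r : ℝ) * Complex.I) := by
        rw [← Complex.exp_nat_mul, show (k : ℂ) * -((δ + r * Complex.I) * h) =
          ((-(δ * h) * k : ℝ) : ℂ) + ((-(k * h) * r : ℝ) : ℂ) * Complex.I by push_cast; ring,
          show (((x - k * h) * r : ℝ) : ℂ) * Complex.I = ((x * r : ℝ) : ℂ) * Complex.I +
            ((-(k * h) * r : ℝ) : ℂ) * Complex.I by push_cast; ring, Complex.exp_add,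
          Complex.exp_add]
        push_cast
        ring
      rw [this, Complex.reCLM_apply, Complex.re_ofReal_mul, Complex.exp_ofReal_mul_I_re]
      ring
    simp_rw [hterm]
    rw [integral_const_mul]
    exact mul_nonneg (mul_nonneg (hb k) (Real.exp_pos _).le)
      (integral_cos_mul_gaussian_nonneg hε _)
  · rw [norm_mul, norm_mul, Complex.norm_exp_ofReal_mul_I, one_mul, Complex.norm_real,
      Real.norm_of_nonneg (Real.exp_pos _).le, norm_mul, norm_pow, hnorm, Complex.norm_real,
      Real.norm_of_nonneg (hb k)]

/-- First-order expansion of the exponential, with error at most `‖s n‖² h n` after division. -/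
lemma tendsto_one_sub_cexp_div {s : ℕ → ℂ} {h : ℕ → ℝ} {w : ℂ} (hs : Tendsto s atTop (𝓝 w))
    (hh : Tendsto h atTop (𝓝 0)) (hpos : ∀ᶠ n in atTop, 0 < h n) :
    Tendsto (fun n => ((h n)⁻¹ : ℂ) * (1 - Complex.exp (-(s n * h n)))) atTop (𝓝 w) := by
  have hhc : Tendsto (fun n => (h n : ℂ)) atTop (𝓝 0) := by
    simpa [Function.comp_def] using (Complex.continuous_ofReal.tendsto 0).comp hh
  have hprod : Tendsto (fun n => -(s n * h n)) atTop (𝓝 0) := by simpa using (hs.mul hhc).neg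
  have herr : Tendsto (fun n => ‖s n‖ ^ 2 * h n) atTop (𝓝 0) := by
    simpa using ((hs.norm.pow 2).mul hh)
  have hdiff : Tendsto (fun n => ((h n)⁻¹ : ℂ) * (1 - Complex.exp (-(s n * h n))) - s n) atTop
      (𝓝 0) := by
    refine squeeze_zero_norm' ?_ herr
    filter_upwards [hpos, hprod.norm.eventually_le_const (u := 1) (by rw [norm_zero]; exact one_pos)] with n hn hn1
    have hn0 : (h n : ℂ) ≠ 0 := by exact_mod_cast hn.ne'
    have hb := Complex.norm_exp_sub_one_sub_id_le hn1
    have heq : ((h n)⁻¹ : ℂ) * (1 - Complex.exp (-(s n * h n))) - s n =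
        -((h n)⁻¹ : ℂ) * (Complex.exp (-(s n * h n)) - 1 - -(s n * h n)) := by
      field_simp
      ring
    rw [heq, norm_mul, norm_neg, norm_inv, Complex.norm_real, Real.norm_of_nonneg hn.le]
    rw [norm_neg, norm_mul, Complex.norm_real, Real.norm_of_nonneg hn.le] at hb
    rw [inv_mul_le_iff₀ hn]
    linarith
  simpa using hdiff.add hs

lemma ofReal_rpow_inv_mul_cpow {μ c : ℝ} (hμ : μ ≠ 0) (hc : 0 < c) {w : ℂ} (hw : w ≠ 0) :
    (((c ^ (1 / μ) : ℝ) : ℂ) * w) ^ (μ : ℂ) = c * w ^ (μ : ℂ) := by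
  have hpos : 0 < c ^ (1 / μ) := by positivity
  have h0 : ((c ^ (1 / μ) : ℝ) : ℂ) ≠ 0 := by exact_mod_cast hpos.ne'
  rw [Complex.cpow_def_of_ne_zero (mul_ne_zero h0 hw), Complex.log_ofReal_mul hpos hw, add_mul,
    Complex.exp_add, ← Complex.cpow_def_of_ne_zero hw, Real.log_rpow hc, ← Complex.ofReal_mul,
    ← Complex.ofReal_exp, show 1 / μ * Real.log c * μ = Real.log c by field_simp,
    Real.exp_log hc]

lemma ofReal_mul_I_cpow {r : ℝ} (hr : 0 < r) (μ : ℝ) :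
    ((r : ℂ) * Complex.I) ^ (μ : ℂ) =
      ((r ^ μ : ℝ) : ℂ) * Complex.exp ((μ * (Real.pi / 2) : ℝ) * Complex.I) := by
  rw [Complex.cpow_def_of_ne_zero (mul_ne_zero (by exact_mod_cast hr.ne') Complex.I_ne_zero),
    Complex.log_ofReal_mul hr Complex.I_ne_zero, Complex.log_I, add_mul, Complex.exp_add,
    ← Complex.ofReal_mul, ← Complex.ofReal_exp, ← Real.rpow_def_of_pos hr]
  congr 2
  push_cast
  ring

/-- Powers of `1 - (1 - z) ^ μ`, rescaled, converge to the symbol of the stable density. -/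
lemma tendsto_one_sub_cpow_pow {μ r : ℝ} (hμ0 : 0 < μ) (hr : 0 < r) :
    Tendsto (fun n : ℕ => (1 - (1 - Complex.exp (-(((1 / (n : ℝ) : ℝ) + r * Complex.I) *
      ((n : ℝ) ^ (-(1 / μ)) : ℝ)))) ^ (μ : ℂ)) ^ n) atTop
      (𝓝 (Complex.exp (-(((r ^ μ : ℝ) : ℂ) *
        Complex.exp ((μ * (Real.pi / 2) : ℝ) * Complex.I))))) := by
  rw [← ofReal_mul_I_cpow hr]
  simp_rw [sub_eq_add_neg (1 : ℂ) (_ ^ (μ : ℂ))]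
  -- With `h = n^(-1/μ)` one has `n (1 - e^(-sh))^μ = ((1 - e^(-sh)) / h)^μ`, and this tends to
  -- `(ir)^μ` for `s = 1/n + ir`.
  refine Complex.tendsto_one_add_pow_exp_of_tendsto ?_
  have hs : Tendsto (fun n : ℕ => ((1 / (n : ℝ) : ℝ) : ℂ) + r * Complex.I) atTop
      (𝓝 (r * Complex.I)) := by
    have := (Complex.continuous_ofReal.tendsto 0).comp tendsto_one_div_atTop_nhds_zero_nat
    simpa using this.add_const (r * Complex.I)
  have hpos : ∀ᶠ n : ℕ in atTop, 0 < (n : ℝ) ^ (-(1 / μ)) := by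
    filter_upwards [eventually_gt_atTop 0] with n hn
    have : (0 : ℝ) < n := by exact_mod_cast hn
    positivity
  have hlim := tendsto_one_sub_cexp_div hs
    ((tendsto_rpow_neg_atTop (one_div_pos.2 hμ0)).comp tendsto_natCast_atTop_atTop) hpos
  have hslit : (r : ℂ) * Complex.I ∈ Complex.slitPlane := Or.inr (by simpa using hr.ne')
  have h2 := ((continuousAt_cpow_const (b := (μ : ℂ)) hslit).tendsto.comp hlim).neg
  refine h2.congr' ?_
  filter_upwards [eventually_gt_atTop 0, hlim.eventually_ne (Complex.slitPlane_ne_zero hslit)]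
    with n hn hne
  have hn0 : (0 : ℝ) < n := by exact_mod_cast hn
  have hne' := right_ne_zero_of_mul hne
  have hinv : ((n : ℝ) ^ (-(1 / μ)))⁻¹ = (n : ℝ) ^ (1 / μ) := by
    rw [Real.rpow_neg hn0.le, inv_inv]
  simp only [Function.comp, mul_neg] at hne' ⊢
  rw [← Complex.ofReal_inv, hinv]
  rw [ofReal_rpow_inv_mul_cpow hμ0.ne' hn0 hne', Complex.ofReal_natCast]

/-- The Gaussian regularisation of the Fourier integral of the stable density is nonnegative. -/
lemma integral_gaussian_symbol_nonneg {μ ε : ℝ} (hμ0 : 0 < μ) (hμ1 : μ < 1) (hε : 0 < ε)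
    (x : ℝ) :
    0 ≤ (∫ r in Ioi (0 : ℝ), Complex.exp ((x * r : ℝ) * Complex.I) * (Real.exp (-ε * r ^ 2) : ℝ) *
      Complex.exp (-(((r ^ μ : ℝ) : ℂ) *
        Complex.exp ((μ * (Real.pi / 2) : ℝ) * Complex.I)))).re := by
  have hlim : Tendsto (fun n : ℕ => ∫ r in Ioi (0 : ℝ), Complex.exp ((x * r : ℝ) * Complex.I) *
      (Real.exp (-ε * r ^ 2) : ℝ) * (1 - (1 - Complex.exp (-(((1 / (n : ℝ) : ℝ) + r * Complex.I) *
      ((n : ℝ) ^ (-(1 / μ)) : ℝ)))) ^ (μ : ℂ)) ^ n) atTop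
      (𝓝 (∫ r in Ioi (0 : ℝ), Complex.exp ((x * r : ℝ) * Complex.I) *
      (Real.exp (-ε * r ^ 2) : ℝ) * Complex.exp (-(((r ^ μ : ℝ) : ℂ) *
        Complex.exp ((μ * (Real.pi / 2) : ℝ) * Complex.I))))) := by
    refine tendsto_integral_filter_of_dominated_convergence (fun r => Real.exp (-ε * r ^ 2))
      ?_ ?_ (integrable_exp_neg_mul_sq hε).integrableOn ?_
    · exact Eventually.of_forall fun n => Measurable.aestronglyMeasurable (by fun_prop)
    · filter_upwards [eventually_gt_atTop 0] with n hn
      have hn0 : (0 : ℝ) < n := by exact_mod_cast hn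
      refine Eventually.of_forall fun r => ?_
      rw [norm_mul, norm_mul, Complex.norm_exp_ofReal_mul_I, one_mul, Complex.norm_real,
        Real.norm_of_nonneg (Real.exp_pos _).le]
      refine mul_le_of_le_one_right (Real.exp_pos _).le (norm_one_sub_cpow_pow_le hμ0 hμ1 ?_ n)
      rw [Complex.norm_exp, Real.exp_lt_one_iff, Complex.neg_re, Complex.re_mul_ofReal]
      have : 0 < (n : ℝ) ^ (-(1 / μ)) := by positivity
      simp only [Complex.add_re, Complex.ofReal_re, Complex.mul_re, Complex.I_re, mul_zero,
        Complex.ofReal_im, Complex.I_im, mul_one, sub_self, add_zero]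
      rw [neg_lt_zero]
      positivity
    · filter_upwards [ae_restrict_mem measurableSet_Ioi] with r hr
      exact (tendsto_one_sub_cpow_pow hμ0 hr).const_mul _
  refine ge_of_tendsto ((Complex.continuous_re.tendsto _).comp hlim) ?_
  filter_upwards [eventually_gt_atTop 0] with n hn
  have hn0 : (0 : ℝ) < n := by exact_mod_cast hn
  exact integral_lattice_nonneg ((hasNonnegCoeffs_one_sub_cpow hμ0 hμ1).pow n) hε
    (by positivity) (by positivity) x

/-- The one-sided stable density is nonnegative. -/
theorem stableDensity_nonneg {μ x : ℝ} (hμ0 : 0 < μ) (hμ1 : μ < 1) (hx : 0 < x) :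
    0 ≤ stableDensity μ x := by
  have hpi := Real.pi_pos
  have hc : 0 < Real.cos (μ * (Real.pi / 2)) :=
    Real.cos_pos_of_mem_Ioo ⟨by nlinarith, by nlinarith⟩
  set K : ℝ → ℂ := fun r => Complex.exp ((x * r : ℝ) * Complex.I) *
    Complex.exp (-(((r ^ μ : ℝ) : ℂ) * Complex.exp ((μ * (Real.pi / 2) : ℝ) * Complex.I))) with hK
  -- On the imaginary axis `dσ = i dr`, so the imaginary part to be estimated is the real part of `∫
  -- K`.
  have hray (r : ℝ) : rayIntegrand μ (Real.pi / 2) x r = Complex.I * K r := by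
    have : Complex.exp (((Real.pi / 2 : ℝ) : ℂ) * Complex.I) = Complex.I := by
      push_cast
      exact Complex.exp_pi_div_two_mul_I
    simp only [rayIntegrand, hK, this]
    rw [show -(-((x : ℂ) * Complex.I) * r) = ((x * r : ℝ) : ℂ) * Complex.I by push_cast; ring]
    ring
  rw [stableDensity_eq_integral_imaginary_ray hμ0 hμ1 hx]
  refine mul_nonneg (by positivity) ?_
  simp_rw [hray]
  rw [integral_const_mul, Complex.I_mul_im]
  have hnormK (r : ℝ) : ‖K r‖ = Real.exp (-Real.cos (μ * (Real.pi / 2)) * r ^ μ) := by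
    rw [hK]
    simp only
    rw [norm_mul, Complex.norm_exp_ofReal_mul_I, one_mul, Complex.norm_exp, Complex.neg_re,
      Complex.re_ofReal_mul, Complex.exp_ofReal_mul_I_re]
    congr 1; ring
  have hmK : Measurable K := by fun_prop
  -- `K` is absolutely integrable, so the Gaussian factor can be removed as `ε` decreases to `0`.
  have hlim : Tendsto (fun ε : ℝ => ∫ r in Ioi (0 : ℝ), (Real.exp (-ε * r ^ 2) : ℂ) * K r)
      (𝓝[>] 0) (𝓝 (∫ r in Ioi (0 : ℝ), K r)) := by
    refine tendsto_integral_filter_of_dominated_convergence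
      (fun r => Real.exp (-Real.cos (μ * (Real.pi / 2)) * r ^ μ)) ?_ ?_
      (integrableOn_exp_neg_mul_rpow hμ0 hc) ?_
    · exact Eventually.of_forall fun ε => Measurable.aestronglyMeasurable (by fun_prop)
    · filter_upwards [self_mem_nhdsWithin] with ε (hε : 0 < ε)
      refine Eventually.of_forall fun r => ?_
      rw [norm_mul, hnormK, Complex.norm_real, Real.norm_of_nonneg (Real.exp_pos _).le]
      refine mul_le_of_le_one_left (Real.exp_pos _).le (Real.exp_le_one_iff.2 ?_)
      nlinarith [sq_nonneg r]
    · refine Eventually.of_forall fun r => ?_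
      have : Continuous fun ε : ℝ => (Real.exp (-ε * r ^ 2) : ℂ) * K r := by fun_prop
      exact (this.tendsto' 0 _ (by simp)).mono_left nhdsWithin_le_nhds
  refine ge_of_tendsto ((Complex.continuous_re.tendsto _).comp hlim) ?_
  filter_upwards [self_mem_nhdsWithin] with ε hε
  have := integral_gaussian_symbol_nonneg hμ0 hμ1 hε x
  simp only [Function.comp]
  refine this.trans_eq (congrArg Complex.re (integral_congr_ae (Eventually.of_forall fun r => ?_)))
  simp only [hK]
  ring

/-! ### The density `ξ_μ`. -/

lemma xi_nonneg {μ θ : ℝ} (hμ0 : 0 < μ) (hμ1 : μ < 1) (hθ : 0 < θ) : 0 ≤ xi μ θ := by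
  have := stableDensity_nonneg hμ0 hμ1 (x := θ ^ (-(1 / μ))) (by positivity)
  unfold xi
  positivity

/-- The first moment of the density `ξ_μ`. -/
theorem integral_mul_xi {μ : ℝ} (hμ0 : 0 < μ) (hμ1 : μ < 1) :
    IntegrableOn (fun θ : ℝ => μ * θ * xi μ θ) (Ioi 0) ∧
      ∫ θ in Ioi (0 : ℝ), μ * θ * xi μ θ = 1 / Real.Gamma μ := by
  obtain ⟨hint, hval⟩ := integral_rpow_mul_stableDensity hμ0 hμ1
  have hp : -(1 / μ) ≠ 0 := neg_ne_zero.2 (one_div_pos.2 hμ0).ne'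
  -- Substitution `x = θ^(-1/μ)`, under which `x^(-μ) = θ`.
  have heq : EqOn (fun θ : ℝ => μ * ((|(-(1 / μ))| * θ ^ (-(1 / μ) - 1)) •
      ((θ ^ (-(1 / μ))) ^ (-μ) * stableDensity μ (θ ^ (-(1 / μ))))))
      (fun θ : ℝ => μ * θ * xi μ θ) (Ioi 0) := fun θ (hθ : 0 < θ) => by
    have h1 : (θ ^ (-(1 / μ))) ^ (-μ) = θ := by
      rw [← Real.rpow_mul hθ.le, show -(1 / μ) * -μ = 1 by field_simp, Real.rpow_one]
    simp only [smul_eq_mul, xi]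
    rw [h1, abs_neg, abs_of_pos (one_div_pos.2 hμ0), show -(1 / μ) - 1 = -1 - 1 / μ by ring]
    ring
  have hint' := (integrableOn_Ioi_comp_rpow_iff
    (fun x : ℝ => x ^ (-μ) * stableDensity μ x) hp).2 hint
  refine ⟨IntegrableOn.congr_fun (hint'.const_mul μ) heq measurableSet_Ioi, ?_⟩
  rw [← setIntegral_congr_fun measurableSet_Ioi heq, integral_const_mul,
    integral_comp_rpow_Ioi (fun x : ℝ => x ^ (-μ) * stableDensity μ x) hp, hval]
  have := (Real.Gamma_pos_of_pos hμ0).ne'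
  field_simp

/-! ### Beta integrals. -/

/-- The Beta integral over `(0, t]`. -/
theorem integral_sub_rpow_mul_rpow {a b t : ℝ} (ha : 0 < a) (hb : 0 < b) (ht : 0 < t) :
    ∫ s in Ioc 0 t, (t - s) ^ (a - 1) * s ^ (b - 1) =
      t ^ (a + b - 1) * (Real.Gamma a * Real.Gamma b / Real.Gamma (a + b)) := by
  have h1 := Complex.betaIntegral_scaled (b : ℂ) (a : ℂ) ht
  have h2 := Complex.Gamma_mul_Gamma_eq_betaIntegral (s := (b : ℂ)) (t := (a : ℂ))
    (by simpa using hb) (by simpa using ha)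
  have hne : Complex.Gamma ((b : ℂ) + a) ≠ 0 := by
    rw [← Complex.ofReal_add, Complex.Gamma_ofReal]
    exact_mod_cast (Real.Gamma_pos_of_pos (add_pos hb ha)).ne'
  rw [mul_comm (Complex.Gamma (_ + _)), ← div_eq_iff hne] at h2
  rw [intervalIntegral.integral_of_le ht.le, ← h2] at h1
  have h3 : ∫ s in Ioc 0 t, ((s : ℂ) ^ ((b : ℂ) - 1) * ((t : ℂ) - s) ^ ((a : ℂ) - 1)) =
      ∫ s in Ioc 0 t, (((t - s) ^ (a - 1) * s ^ (b - 1) : ℝ) : ℂ) := by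
    refine setIntegral_congr_fun measurableSet_Ioc fun s hs => ?_
    rw [Complex.ofReal_mul, Complex.ofReal_cpow hs.1.le, Complex.ofReal_cpow (by linarith [hs.2])]
    push_cast
    ring
  rw [h3, integral_complex_ofReal] at h1
  have h4 : ((b : ℂ) + a - 1) = ((a + b - 1 : ℝ) : ℂ) := by push_cast; ring
  rw [h4, ← Complex.ofReal_cpow ht.le, ← Complex.ofReal_add, Complex.Gamma_ofReal,
    Complex.Gamma_ofReal, Complex.Gamma_ofReal, add_comm b a, mul_comm (Real.Gamma b : ℂ)] at h1
  exact_mod_cast h1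

/-- Otherwise the Bochner integral would have its default value `0`, while the Beta value is
positive. -/
lemma integrableOn_sub_rpow_mul_rpow {a b t : ℝ} (ha : 0 < a) (hb : 0 < b) (ht : 0 < t) :
    IntegrableOn (fun s => (t - s) ^ (a - 1) * s ^ (b - 1)) (Ioc 0 t) := by
  by_contra h
  have h1 := integral_sub_rpow_mul_rpow ha hb ht
  rw [integral_undef h] at h1
  have := Real.Gamma_pos_of_pos ha
  have := Real.Gamma_pos_of_pos hb
  have := Real.Gamma_pos_of_pos (add_pos ha hb)
  have : 0 < t ^ (a + b - 1) * (Real.Gamma a * Real.Gamma b / Real.Gamma (a + b)) := by positivity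
  linarith

/-! ### Bounds for the operators `P_μ` and `S_{μ,ν}`. -/

section Operators

variable {E : Type*} [NormedAddCommGroup E] [NormedSpace ℝ E]

/-- Since `ξ_μ ≥ 0`, the norm enters the integral without loss and the first moment gives the factor
`1 / Γ(μ)`. -/
lemma norm_opP_le {Q : ℝ → E →L[ℝ] E} {M μ t : ℝ} (hQ : ∀ s, 0 ≤ s → ‖Q s‖ ≤ M) (hμ0 : 0 < μ)
    (hμ1 : μ < 1) (ht : 0 ≤ t) (x : E) : ‖opP Q μ t x‖ ≤ M / Real.Gamma μ * ‖x‖ := by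
  obtain ⟨hint, hval⟩ := integral_mul_xi hμ0 hμ1
  have h := norm_integral_le_of_norm_le (hint.mul_const (M * ‖x‖))
    (f := fun θ => (μ * θ * xi μ θ) • Q (t ^ μ * θ) x) ?_
  · rw [integral_mul_const, hval] at h
    refine h.trans_eq ?_
    ring
  · filter_upwards [ae_restrict_mem measurableSet_Ioi] with θ (hθ : 0 < θ)
    have hxi := xi_nonneg hμ0 hμ1 hθ
    have h0 : 0 ≤ t ^ μ * θ := by positivity
    rw [norm_smul, Real.norm_of_nonneg (by positivity)]
    gcongr
    exact ((Q _).le_opNorm x).trans (by gcongr; exact hQ _ h0)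

lemma hlam_pos {μ ν : ℝ} (hμ0 : 0 < μ) (hμ1 : μ < 1) (hν0 : 0 ≤ ν) : 0 < hlam μ ν := by
  unfold hlam; nlinarith

lemma hlam_le_one {μ ν : ℝ} (hμ1 : μ < 1) (hν1 : ν ≤ 1) : hlam μ ν ≤ 1 := by
  unfold hlam; nlinarith

/-- For `a = ν(1-μ) > 0` the Beta integral yields `Γ(a) Γ(μ) / Γ(λ)` because `a + μ = λ`; the Gamma
factors of `I^a` and `P_μ` cancel. If `a = 0`, the bound is that of `P_μ` itself. -/
lemma norm_opS_le {Q : ℝ → E →L[ℝ] E} {M μ ν t : ℝ} (hQ : ∀ s, 0 ≤ s → ‖Q s‖ ≤ M) (hμ0 : 0 < μ)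
    (hμ1 : μ < 1) (hν0 : 0 ≤ ν) (ht : 0 < t) (x : E) :
    ‖opS Q μ ν t x‖ ≤ M / Real.Gamma (hlam μ ν) * t ^ (hlam μ ν - 1) * ‖x‖ := by
  have hlam_eq : hlam μ ν = ν * (1 - μ) + μ := by unfold hlam; ring
  have hΓ := Real.Gamma_pos_of_pos hμ0
  have ha0 : 0 ≤ ν * (1 - μ) := mul_nonneg hν0 (by linarith)
  rw [hlam_eq]
  unfold opS fracInt
  split_ifs with ha
  · rw [ha, zero_add, norm_smul, Real.norm_of_nonneg (by positivity)]
    refine (mul_le_mul_of_nonneg_left (norm_opP_le hQ hμ0 hμ1 ht.le x)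
      (by positivity)).trans_eq (by ring)
  · have ha' : 0 < ν * (1 - μ) := lt_of_le_of_ne ha0 (Ne.symm ha)
    set a := ν * (1 - μ)
    have hΓa := Real.Gamma_pos_of_pos ha'
    have h := norm_integral_le_of_norm_le
      ((integrableOn_sub_rpow_mul_rpow ha' hμ0 ht).mul_const (M / Real.Gamma μ * ‖x‖))
      (f := fun s => (t - s) ^ (a - 1) • s ^ (μ - 1) • opP Q μ s x) ?_
    · rw [integral_mul_const, integral_sub_rpow_mul_rpow ha' hμ0 ht] at h
      rw [norm_smul, Real.norm_of_nonneg (by positivity)]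
      refine (mul_le_mul_of_nonneg_left h (by positivity)).trans_eq ?_
      field_simp
    · filter_upwards [ae_restrict_mem measurableSet_Ioc] with s hs
      have h1 : 0 ≤ t - s := by linarith [hs.2]
      have h2 := hs.1
      rw [norm_smul, norm_smul, Real.norm_of_nonneg (by positivity),
        Real.norm_of_nonneg (by positivity), ← mul_assoc]
      exact mul_le_mul_of_nonneg_left (norm_opP_le hQ hμ0 hμ1 hs.1.le x) (by positivity)

end Operators

/-! ### The Mittag-Leffler series and Picard iterates. -/

/-- Log-convexity of `Γ`: the slope of `log Γ` on `[y-1, y]`, equal to `log (y-1)`, is at most its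
slope on `[y, y+μ]`. -/
lemma rpow_mul_Gamma_le {μ y : ℝ} (hμ0 : 0 < μ) (hy : 1 < y) :
    (y - 1) ^ μ * Real.Gamma y ≤ Real.Gamma (y + μ) := by
  have h1 : 0 < y - 1 := by linarith
  have hΓ1 := Real.Gamma_pos_of_pos h1
  have hΓy := Real.Gamma_pos_of_pos (show 0 < y by linarith)
  have hΓ := Real.Gamma_pos_of_pos (show 0 < y + μ by linarith)
  have h := Real.convexOn_log_Gamma.slope_mono_adjacent (x := y - 1) (y := y) (z := y + μ)
    h1 (show 0 < y + μ by linarith) (by linarith) (by linarith)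
  have hrec : Real.Gamma y = (y - 1) * Real.Gamma (y - 1) := by
    rw [← Real.Gamma_add_one h1.ne']; congr 1; ring
  simp only [Function.comp] at h
  have hlog : Real.log (Real.Gamma y) = Real.log (y - 1) + Real.log (Real.Gamma (y - 1)) := by
    rw [hrec, Real.log_mul h1.ne' hΓ1.ne']
  rw [show y - (y - 1) = 1 by ring, show y + μ - y = μ by ring, div_one, le_div_iff₀ hμ0] at h
  rw [← Real.log_le_log_iff (by positivity) hΓ, Real.log_mul (by positivity) hΓy.ne',
    Real.log_rpow h1]
  nlinarith

/-- The Mittag-Leffler series converges. -/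
theorem summable_mittagLeffler {μ z : ℝ} (hμ0 : 0 < μ) (hz : 0 ≤ z) :
    Summable fun n : ℕ => z ^ n / Real.Gamma (μ * n + 1) := by
  -- This sequence bounds the ratio of consecutive terms.
  have hlim : Tendsto (fun n : ℕ => z * (μ * (n : ℝ)) ^ (-μ)) atTop (𝓝 0) := by
    have h1 : Tendsto (fun n : ℕ => μ * (n : ℝ)) atTop atTop :=
      tendsto_natCast_atTop_atTop.const_mul_atTop hμ0
    simpa using ((tendsto_rpow_neg_atTop hμ0).comp h1).const_mul z
  refine summable_of_ratio_norm_eventually_le (r := 1 / 2) (by norm_num) ?_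
  filter_upwards [hlim.eventually_le_const (u := 1 / 2) (by norm_num), eventually_gt_atTop 0]
    with n hn hn0
  have hμn : 0 < μ * n := by have : (0 : ℝ) < n := by exact_mod_cast hn0
                             positivity
  have hΓ := Real.Gamma_pos_of_pos (show 0 < μ * n + 1 by linarith)
  have hb := rpow_mul_Gamma_le hμ0 (y := μ * n + 1) (by linarith)
  rw [add_sub_cancel_right] at hb
  have heq : μ * ((n + 1 : ℕ) : ℝ) + 1 = μ * n + 1 + μ := by push_cast; ring
  have hΓ' := Real.Gamma_pos_of_pos (show 0 < μ * n + 1 + μ by linarith)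
  have hpw : 0 < (μ * n) ^ μ := by positivity
  rw [heq, Real.norm_of_nonneg (by positivity), Real.norm_of_nonneg (by positivity)]
  calc z ^ (n + 1) / Real.Gamma (μ * n + 1 + μ)
      ≤ z ^ (n + 1) / ((μ * n) ^ μ * Real.Gamma (μ * n + 1)) := by gcongr
    _ = (z * (μ * n) ^ (-μ)) * (z ^ n / Real.Gamma (μ * n + 1)) := by
        rw [Real.rpow_neg hμn.le, pow_succ]; field_simp
    _ ≤ _ := by gcongr

/-- The `m`-th Picard iterate of `u ↦ a + κ I^μ u`, started at the constant `K`. -/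
noncomputable def volterraIterate (μ a κ K : ℝ) (m : ℕ) (s : ℝ) : ℝ :=
  a * ∑ j ∈ Finset.range m, (κ * s ^ μ) ^ j / Real.Gamma (μ * j + 1) +
    K * ((κ * s ^ μ) ^ m / Real.Gamma (μ * m + 1))

section Volterra

variable {μ a κ K : ℝ}

lemma Gamma_mul_natCast_add_one_pos (hμ0 : 0 < μ) (j : ℕ) : 0 < Real.Gamma (μ * j + 1) :=
  Real.Gamma_pos_of_pos (by positivity)

lemma mul_rpow_pow_eq {r : ℝ} (hr : 0 < r) (j : ℕ) :
    (κ * r ^ μ) ^ j = κ ^ j * r ^ ((μ * j + 1) - 1) := by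
  rw [mul_pow, add_sub_cancel_right, Real.rpow_mul hr.le, Real.rpow_natCast]

lemma integrableOn_kernel_term (hμ0 : 0 < μ) {s : ℝ} (hs : 0 < s) (j : ℕ) :
    IntegrableOn (fun r => (s - r) ^ (μ - 1) * ((κ * r ^ μ) ^ j / Real.Gamma (μ * j + 1)))
      (Ioc 0 s) := by
  refine IntegrableOn.congr_fun ((integrableOn_sub_rpow_mul_rpow (b := μ * j + 1) hμ0
    (by positivity) hs).const_mul (κ ^ j / Real.Gamma (μ * j + 1))) (fun r hr => ?_)
    measurableSet_Ioc
  rw [mul_rpow_pow_eq hr.1]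
  ring

lemma integral_kernel_term (hμ0 : 0 < μ) {s : ℝ} (hs : 0 < s) (j : ℕ) :
    κ / Real.Gamma μ *
      ∫ r in Ioc 0 s, (s - r) ^ (μ - 1) * ((κ * r ^ μ) ^ j / Real.Gamma (μ * j + 1)) =
      (κ * s ^ μ) ^ (j + 1) / Real.Gamma (μ * (j + 1 : ℕ) + 1) := by
  have hb : 0 < μ * j + 1 := by positivity
  have h1 : ∫ r in Ioc 0 s, (s - r) ^ (μ - 1) * ((κ * r ^ μ) ^ j / Real.Gamma (μ * j + 1)) =
      ∫ r in Ioc 0 s, (κ ^ j / Real.Gamma (μ * j + 1)) *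
        ((s - r) ^ (μ - 1) * r ^ ((μ * j + 1) - 1)) := by
    refine setIntegral_congr_fun measurableSet_Ioc fun r hr => ?_
    rw [mul_rpow_pow_eq hr.1]
    ring
  have hΓμ := (Real.Gamma_pos_of_pos hμ0).ne'
  have hΓb := (Real.Gamma_pos_of_pos hb).ne'
  rw [h1, integral_const_mul, integral_sub_rpow_mul_rpow hμ0 hb hs, mul_rpow_pow_eq hs,
    show μ * ((j + 1 : ℕ) : ℝ) + 1 = μ + (μ * j + 1) by push_cast; ring, pow_succ]
  field_simp

lemma kernel_mul_volterraIterate (s r : ℝ) (m : ℕ) :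
    (s - r) ^ (μ - 1) * volterraIterate μ a κ K m r =
      a * ∑ j ∈ Finset.range m,
        (s - r) ^ (μ - 1) * ((κ * r ^ μ) ^ j / Real.Gamma (μ * j + 1)) +
      K * ((s - r) ^ (μ - 1) * ((κ * r ^ μ) ^ m / Real.Gamma (μ * m + 1))) := by
  rw [volterraIterate, ← Finset.mul_sum]
  ring

lemma integrableOn_kernel_mul_volterraIterate (hμ0 : 0 < μ) {s : ℝ} (hs : 0 < s) (m : ℕ) :
    IntegrableOn (fun r => (s - r) ^ (μ - 1) * volterraIterate μ a κ K m r) (Ioc 0 s) := by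
  simp_rw [kernel_mul_volterraIterate]
  exact ((integrable_finsetSum _ fun j _ => integrableOn_kernel_term hμ0 hs j).const_mul a).add
    ((integrableOn_kernel_term hμ0 hs m).const_mul K)

/-- Exact recursion: by the Beta integral, `κ I^μ` sends each Mittag-Leffler term to the next one.
-/
lemma volterraIterate_succ (hμ0 : 0 < μ) {s : ℝ} (hs : 0 < s) (m : ℕ) :
    volterraIterate μ a κ K (m + 1) s =
      a + κ / Real.Gamma μ *
        ∫ r in Ioc 0 s, (s - r) ^ (μ - 1) * volterraIterate μ a κ K m r := by
  simp_rw [kernel_mul_volterraIterate]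
  rw [integral_add ((integrable_finsetSum _ fun j _ =>
      integrableOn_kernel_term hμ0 hs j).const_mul a)
    ((integrableOn_kernel_term hμ0 hs m).const_mul K), integral_const_mul, integral_const_mul,
    integral_finsetSum _ fun j _ => integrableOn_kernel_term hμ0 hs j, mul_add,
    mul_left_comm _ a, Finset.mul_sum, mul_left_comm _ K, integral_kernel_term hμ0 hs m]
  simp_rw [integral_kernel_term hμ0 hs]
  rw [volterraIterate, Finset.sum_range_succ']
  simp
  ring

/-- Needed to compare the iterate at an earlier impulse time with its value at the current time. -/
lemma volterraIterate_mono (hμ0 : 0 < μ) (ha : 0 ≤ a) (hκ : 0 ≤ κ) (hK : 0 ≤ K) (m : ℕ)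
    {r s : ℝ} (hr : 0 ≤ r) (hrs : r ≤ s) :
    volterraIterate μ a κ K m r ≤ volterraIterate μ a κ K m s := by
  have hΓ (j : ℕ) := (Gamma_mul_natCast_add_one_pos hμ0 j).le
  have hpow (j : ℕ) : (κ * r ^ μ) ^ j / Real.Gamma (μ * j + 1) ≤
      (κ * s ^ μ) ^ j / Real.Gamma (μ * j + 1) := by
    refine div_le_div_of_nonneg_right (pow_le_pow_left₀ (by positivity) ?_ j) (hΓ j)
    gcongr
  unfold volterraIterate
  exact add_le_add (mul_le_mul_of_nonneg_left (Finset.sum_le_sum fun j _ => hpow j) ha)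
    (mul_le_mul_of_nonneg_left (hpow m) hK)

/-- The `K`-part is a single term of a convergent series, so the starting constant leaves no trace
in the limit. -/
lemma tendsto_volterraIterate (hμ0 : 0 < μ) (hκ : 0 ≤ κ) {s : ℝ} (hs : 0 ≤ s) :
    Tendsto (fun m => volterraIterate μ a κ K m s) atTop
      (𝓝 (a * mittagLeffler μ (κ * s ^ μ))) := by
  have hsum := summable_mittagLeffler hμ0 (z := κ * s ^ μ) (by positivity)
  simpa [volterraIterate, mittagLeffler] using
    (hsum.hasSum.tendsto_sum_nat.const_mul a).add (hsum.tendsto_atTop_zero.const_mul K)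

lemma mittagLeffler_mono (hμ0 : 0 < μ) {y z : ℝ} (hy : 0 ≤ y) (hyz : y ≤ z) :
    mittagLeffler μ y ≤ mittagLeffler μ z :=
  (summable_mittagLeffler hμ0 hy).tsum_le_tsum
    (fun n => div_le_div_of_nonneg_right (pow_le_pow_left₀ hy hyz n)
      (Gamma_mul_natCast_add_one_pos hμ0 n).le) (summable_mittagLeffler hμ0 (hy.trans hyz))

end Volterra

/-! ### Hölder estimate for the singular kernel. -/

/-- Hölder's inequality for the Riemann-Liouville kernel. -/
theorem integral_kernel_mul_le {μ p s T : ℝ} (hμ0 : 0 < μ) (hμ1 : μ < 1) (hp : 1 / μ < p)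
    (hs : 0 < s) (hsT : s ≤ T) {α : ℝ → ℝ} (hα0 : ∀ r ∈ Icc 0 T, 0 ≤ α r)
    (hα : MemLp α (ENNReal.ofReal p) (volume.restrict (Icc 0 T))) :
    IntegrableOn (fun r => (s - r) ^ (μ - 1) * α r) (Ioc 0 s) ∧
      ∫ r in Ioc 0 s, (s - r) ^ (μ - 1) * α r ≤
        s ^ (μ - 1 / p) * ((p - 1) / (p * μ - 1)) ^ (1 - 1 / p) *
          (eLpNorm α (ENNReal.ofReal p) (volume.restrict (Icc 0 T))).toReal := by
  have hp1 : 1 < p := lt_trans (by rw [one_lt_div hμ0]; exact hμ1) hp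
  have hp0 : 0 < p := by linarith
  have hpμ : 0 < p * μ - 1 := by rw [div_lt_iff₀ hμ0] at hp; linarith
  have hpq := Real.HolderConjugate.conjExponent hp1
  set q := p.conjExponent with hq
  have hqe : q = p / (p - 1) := rfl
  have hq0 : 0 < q := hpq.symm.pos
  have hqinv : 1 / q = 1 - 1 / p := by
    have := hpq.inv_add_inv_eq_one; rw [one_div, one_div]; linarith
  have hsub : Ioc 0 s ⊆ Icc 0 T := fun r hr => ⟨hr.1.le, hr.2.trans hsT⟩
  have hle : volume.restrict (Ioc 0 s) ≤ volume.restrict (Icc 0 T) :=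
    Measure.restrict_mono hsub le_rfl
  have hαs := hα.mono_measure hle
  -- The exponent exceeds `-1` because `p > 1/μ`; this puts the kernel in `L^q`.
  have hqa : (μ - 1) * q = (p * μ - 1) / (p - 1) - 1 := by
    rw [hqe]; have : p - 1 ≠ 0 := by linarith
    field_simp; ring
  have ha : 0 < (p * μ - 1) / (p - 1) := div_pos hpμ (by linarith)
  have hpow {r : ℝ} (hr : r ∈ Ioc 0 s) : ((s - r) ^ (μ - 1)) ^ q =
      (s - r) ^ ((p * μ - 1) / (p - 1) - 1) * r ^ ((1 : ℝ) - 1) := by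
    rw [← Real.rpow_mul (by linarith [hr.2]), hqa, sub_self, Real.rpow_zero, mul_one]
  have hk0 {r : ℝ} (hr : r ∈ Ioc 0 s) : 0 ≤ (s - r) ^ (μ - 1) :=
    Real.rpow_nonneg (by linarith [hr.2]) _
  have hk : MemLp (fun r => (s - r) ^ (μ - 1)) (ENNReal.ofReal q)
      (volume.restrict (Ioc 0 s)) := by
    refine (integrable_norm_rpow_iff (Measurable.aestronglyMeasurable (by fun_prop))
      (by simpa using hq0) ENNReal.ofReal_ne_top).1 ?_
    rw [ENNReal.toReal_ofReal hq0.le]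
    refine IntegrableOn.congr_fun (integrableOn_sub_rpow_mul_rpow ha one_pos hs) (fun r hr => ?_)
      measurableSet_Ioc
    rw [Real.norm_of_nonneg (hk0 hr), hpow hr]
  have hkint : ∫ r in Ioc 0 s, ((s - r) ^ (μ - 1)) ^ q =
      s ^ ((p * μ - 1) / (p - 1)) * ((p - 1) / (p * μ - 1)) := by
    rw [setIntegral_congr_fun measurableSet_Ioc fun r hr => hpow hr,
      integral_sub_rpow_mul_rpow ha one_pos hs, Real.Gamma_one, Real.Gamma_add_one ha.ne',
      add_sub_cancel_right]
    have := (Real.Gamma_pos_of_pos ha).ne'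
    congr 1
    rw [mul_one, div_mul_cancel_right₀ this, inv_div]
  have hnormα : (∫ r in Ioc 0 s, α r ^ p) ^ (1 / p) ≤
      (eLpNorm α (ENNReal.ofReal p) (volume.restrict (Icc 0 T))).toReal := by
    have h1 := hαs.eLpNorm_eq_integral_rpow_norm (by simpa using hp0) ENNReal.ofReal_ne_top
    rw [ENNReal.toReal_ofReal hp0.le] at h1
    have h2 : ∫ r in Ioc 0 s, ‖α r‖ ^ p = ∫ r in Ioc 0 s, α r ^ p :=
      setIntegral_congr_fun measurableSet_Ioc fun r hr => by
        simp only [Real.norm_of_nonneg (hα0 r (hsub hr))]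
    have h3 : 0 ≤ ∫ r in Ioc 0 s, α r ^ p :=
      setIntegral_nonneg measurableSet_Ioc fun r hr => Real.rpow_nonneg (hα0 r (hsub hr)) _
    rw [h2] at h1
    have h4 := ENNReal.toReal_mono hα.2.ne (eLpNorm_mono_measure α hle)
    rwa [h1, ENNReal.toReal_ofReal (by positivity), ← one_div] at h4
  have hexp : (s ^ ((p * μ - 1) / (p - 1)) * ((p - 1) / (p * μ - 1))) ^ (1 / q) =
      s ^ (μ - 1 / p) * ((p - 1) / (p * μ - 1)) ^ (1 - 1 / p) := by
    rw [Real.mul_rpow (by positivity) (div_nonneg (by linarith) hpμ.le), ← Real.rpow_mul hs.le,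
      hqinv]
    congr 2
    have : p - 1 ≠ 0 := by linarith
    field_simp
  have hconj := hpq.ennrealOfReal
  refine ⟨?_, ?_⟩
  · have := hconj.symm
    exact hk.integrable_mul hαs
  · have h := integral_mul_le_Lp_mul_Lq_of_nonneg hpq.symm (μ := volume.restrict (Ioc 0 s))
      (f := fun r => (s - r) ^ (μ - 1)) (g := α)
      (by filter_upwards [ae_restrict_mem measurableSet_Ioc] with r hr using hk0 hr)
      (by filter_upwards [ae_restrict_mem measurableSet_Ioc] with r hr using hα0 r (hsub hr))
      hk hαs
    rw [hkint, hexp] at h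
    refine h.trans (mul_le_mul_of_nonneg_left hnormα ?_)
    have : 0 ≤ (p - 1) / (p * μ - 1) := div_nonneg (by linarith) hpμ.le
    positivity

/-! ### The integral inequality for trajectories. -/

section Partition

variable {n : ℕ} {T : ℝ} {t : ℕ → ℝ}

lemma IsPartition.mono (ht : IsPartition n T t) {i j : ℕ} (hij : i ≤ j) (hj : j ≤ n + 1) :
    t i ≤ t j := by
  induction j, hij using Nat.le_induction with
  | base => exact le_rfl
  | succ j hij ih => exact (ih (by omega)).trans (ht.lt j (by omega)).le

lemma IsPartition.nonneg (ht : IsPartition n T t) {j : ℕ} (hj : j ≤ n + 1) : 0 ≤ t j :=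
  ht.left ▸ ht.mono (Nat.zero_le j) hj

lemma IsPartition.le_right (ht : IsPartition n T t) {j : ℕ} (hj : j ≤ n + 1) : t j ≤ T :=
  ht.right ▸ ht.mono hj le_rfl

lemma IsPartition.exists_mem_piece (ht : IsPartition n T t) {k : ℕ} {r : ℝ}
    (hr : r ∈ Ioc 0 (t (k + 1))) : ∃ j ≤ k, r ∈ Ioc (t j) (t (j + 1)) := by
  induction k with
  | zero => exact ⟨0, le_rfl, ht.left ▸ hr.1, hr.2⟩
  | succ k ih =>
    by_cases h : r ≤ t (k + 1)
    · obtain ⟨j, hj, hjr⟩ := ih ⟨hr.1, h⟩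
      exact ⟨j, by omega, hjr⟩
    · exact ⟨k + 1, le_rfl, not_le.1 h, hr.2⟩

end Partition

/-- The weighted norm of `x` is at most `u` on the intervals with index at most `k`. -/
def WeightedLE {E : Type*} [NormedAddCommGroup E] (lam : ℝ) (t : ℕ → ℝ) (k : ℕ) (x : ℝ → E)
    (u : ℝ → ℝ) : Prop :=
  ∀ j ≤ k, ∀ s ∈ Ioc (t j) (t (j + 1)), (s - t j) ^ (1 - lam) * ‖x s‖ ≤ u s

section Field

variable {E : Type*} [NormedAddCommGroup E] [NormedSpace ℝ E]
variable {Λ : Type*} [TopologicalSpace Λ] [MeasurableSpace Λ]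
variable {n : ℕ} {T : ℝ} {t : ℕ → ℝ}

/-- The growth condition at the origin gives `α`, the Lipschitz condition gives `L` times the
weighted norm, and averaging against a probability measure preserves a bound uniform in `η`. -/
lemma norm_relaxedField_le {lam p β L : ℝ} {g : ℝ → E → Λ → E} {α : ℝ → ℝ} {v : ℝ → Measure Λ}
    (ht : IsPartition n T t) (hg : HypG n T t lam p g α β L) (hv : IsRelaxedControl T v)
    {k : ℕ} (hk : k ≤ n) {x : ℝ → E} {u : ℝ → ℝ} (hu : WeightedLE lam t k x u) {s : ℝ}
    (hs : s ∈ Ioc (t k) (t (k + 1))) :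
    ∀ᵐ r ∂(volume.restrict (Ioc 0 s)), ‖relaxedField g r (x r) (v r)‖ ≤ α r + L * u r := by
  have hsT : s ≤ T := hs.2.trans (ht.le_right (by omega))
  have hle : volume.restrict (Ioc 0 s) ≤ volume.restrict (Icc 0 T) :=
    Measure.restrict_mono (fun _ hr => And.intro hr.1.le (hr.2.trans hsT)) le_rfl
  have hgrowth : ∀ᵐ r ∂(volume : Measure ℝ), ∀ j ≤ n, r ∈ Ioc (t j) (t (j + 1)) →
      ∀ y η, ‖g r y η‖ ≤ α r + β * (r - t j) ^ (1 - lam) * ‖y‖ := by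
    rw [ae_all_iff]
    intro j
    by_cases hj : j ≤ n
    · filter_upwards [(ae_restrict_iff' measurableSet_Ioc).1 (hg.growth j hj)] with r hr _ using hr
    · exact Eventually.of_forall fun r h => absurd h hj
  filter_upwards [ae_mono hle hv.prob, ae_restrict_of_ae hgrowth,
    ae_restrict_mem measurableSet_Ioc] with r hprob hr hrs
  obtain ⟨j, hj, hjr⟩ := ht.exists_mem_piece (k := k) ⟨hrs.1, hrs.2.trans hs.2⟩
  have hbound : ∀ η, ‖g r (x r) η‖ ≤ α r + L * u r := fun η => by
    have h1 := hr j (hj.trans hk) hjr 0 η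
    have h2 := hg.lipschitz j (hj.trans hk) r hjr (x r) 0 η
    have h3 := mul_le_mul_of_nonneg_left (hu j hj r hjr) hg.L_pos.le
    rw [norm_zero, mul_zero, add_zero] at h1
    rw [sub_zero] at h2
    have h4 := norm_le_norm_add_norm_sub' (g r (x r) η) (g r 0 η)
    linarith
  have := norm_integral_le_of_norm_le_const (μ := v r) (Eventually.of_forall hbound)
  simpa [relaxedField] using this

end Field

/-- The weight attached to the latest impulse time absorbs the singularity of `S_{μ,ν}` issuing from
any earlier one. -/
lemma sub_rpow_mul_sub_rpow_le_one {lam s a b : ℝ} (hlam : lam ≤ 1) (hab : a ≤ b) (hbs : b < s) :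
    (s - b) ^ (1 - lam) * (s - a) ^ (lam - 1) ≤ 1 := by
  have h1 : 0 < s - a := by linarith
  have h2 : 0 < s - b := by linarith
  calc (s - b) ^ (1 - lam) * (s - a) ^ (lam - 1)
      ≤ (s - a) ^ (1 - lam) * (s - a) ^ (lam - 1) := by gcongr
    _ = 1 := by rw [← Real.rpow_add h1]; simp

section Trajectory

variable {E : Type*} [NormedAddCommGroup E] [NormedSpace ℝ E]
variable {Λ : Type*} [TopologicalSpace Λ] [MeasurableSpace Λ]
variable {n : ℕ} {T : ℝ} {t : ℕ → ℝ}

lemma norm_mildIntegral_le {lam p β L μ M : ℝ} {Q : ℝ → E →L[ℝ] E} {g : ℝ → E → Λ → E}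
    {α : ℝ → ℝ} {v : ℝ → Measure Λ} (hμ0 : 0 < μ) (hμ1 : μ < 1) (hp : 1 / μ < p)
    (ht : IsPartition n T t) (hQ : ∀ s, 0 ≤ s → ‖Q s‖ ≤ M) (hg : HypG n T t lam p g α β L)
    (hv : IsRelaxedControl T v) {k : ℕ} (hk : k ≤ n) {x : ℝ → E} {u : ℝ → ℝ}
    (hu : WeightedLE lam t k x u) {s : ℝ} (hs : s ∈ Ioc (t k) (t (k + 1)))
    (hint : IntegrableOn (fun r => (s - r) ^ (μ - 1) * u r) (Ioc 0 s)) :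
    ‖∫ r in Ioc 0 s, (s - r) ^ (μ - 1) • opP Q μ (s - r) (relaxedField g r (x r) (v r))‖ ≤
      M / Real.Gamma μ * (s ^ (μ - 1 / p) * ((p - 1) / (p * μ - 1)) ^ (1 - 1 / p) *
          (eLpNorm α (ENNReal.ofReal p) (volume.restrict (Icc 0 T))).toReal +
        L * ∫ r in Ioc 0 s, (s - r) ^ (μ - 1) * u r) := by
  have hs0 : 0 < s := (ht.nonneg (by omega)).trans_lt hs.1
  have hM : 0 ≤ M := (norm_nonneg _).trans (hQ 0 le_rfl)
  have hΓ := Real.Gamma_pos_of_pos hμ0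
  obtain ⟨hα1, hα2⟩ := integral_kernel_mul_le hμ0 hμ1 hp hs0
    (hs.2.trans (ht.le_right (by omega))) hg.α_nonneg hg.α_memLp
  have h := norm_integral_le_of_norm_le ((hα1.add (hint.const_mul L)).const_mul (M / Real.Gamma μ))
    (f := fun r => (s - r) ^ (μ - 1) • opP Q μ (s - r) (relaxedField g r (x r) (v r))) ?_
  · refine h.trans ?_
    rw [integral_const_mul]
    refine mul_le_mul_of_nonneg_left ?_ (by positivity)
    simp only [Pi.add_apply]
    rw [integral_add hα1 (hint.const_mul L), integral_const_mul]
    gcongr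
  · filter_upwards [norm_relaxedField_le ht hg hv hk hu hs, ae_restrict_mem measurableSet_Ioc]
      with r hr hrs
    have h0 : 0 ≤ s - r := by linarith [hrs.2]
    rw [norm_smul, Real.norm_of_nonneg (by positivity)]
    calc (s - r) ^ (μ - 1) * ‖opP Q μ (s - r) (relaxedField g r (x r) (v r))‖
        ≤ (s - r) ^ (μ - 1) * (M / Real.Gamma μ * (α r + L * u r)) := by
          gcongr
          exact (norm_opP_le hQ hμ0 hμ1 h0 _).trans (by gcongr)
      _ = _ := by simp only [Pi.add_apply]; ring

/-- The integral inequality satisfied by the weighted norm of a trajectory. -/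
theorem weighted_norm_le_of_trajectory {p β L μ ν M : ℝ} {Q : ℝ → E →L[ℝ] E}
    {g : ℝ → E → Λ → E} {α : ℝ → ℝ} {v : ℝ → Measure Λ} {φ : ℕ → ℝ → E → E} {h : ℕ → ℝ} {x₀ : E}
    (hμ0 : 0 < μ) (hμ1 : μ < 1) (hν0 : 0 ≤ ν) (hν1 : ν ≤ 1) (hp : 1 / μ < p)
    (ht : IsPartition n T t) (hQ : ∀ s, 0 ≤ s → ‖Q s‖ ≤ M)
    (hg : HypG n T t (hlam μ ν) p g α β L) (hφ : HypH n t (hlam μ ν) M φ h)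
    (hv : IsRelaxedControl T v) {x : ℝ → E} (hx : IsRelaxedTrajectory n t μ ν Q g φ x₀ v x)
    {k : ℕ} (hk : k ≤ n) {u : ℝ → ℝ} (hu : WeightedLE (hlam μ ν) t k x u) {s : ℝ}
    (hs : s ∈ Ioc (t k) (t (k + 1)))
    (hint : IntegrableOn (fun r => (s - r) ^ (μ - 1) * u r) (Ioc 0 s)) :
    (s - t k) ^ (1 - hlam μ ν) * ‖x s‖ ≤ tau T t μ ν p M φ x₀ α k +
      M / Real.Gamma (hlam μ ν) * ∑ i ∈ Finset.Icc 1 k, h i * ‖x (t i)‖ +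
      M * T ^ (1 - hlam μ ν) * L / Real.Gamma μ * ∫ r in Ioc 0 s, (s - r) ^ (μ - 1) * u r := by
  set lam := hlam μ ν with hlam_def
  have hlam1 : lam ≤ 1 := hlam_le_one hμ1 hν1
  have hΓlam := Real.Gamma_pos_of_pos (hlam_pos hμ0 hμ1 hν0)
  rw [← hlam_def] at hΓlam
  have hΓ := Real.Gamma_pos_of_pos hμ0
  have htk : 0 ≤ t k := ht.nonneg (by omega)
  have hs0 : 0 < s := htk.trans_lt hs.1
  have hsT : s ≤ T := hs.2.trans (ht.le_right (by omega))
  have hT0 : 0 < T := hs0.trans_le hsT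
  have hM : 0 ≤ M := (norm_nonneg _).trans (hQ 0 le_rfl)
  have hpμ : 1 < p * μ := by rwa [div_lt_iff₀ hμ0] at hp
  have hp1 : 1 < p := lt_trans (by rw [one_lt_div hμ0]; exact hμ1) hp
  set W := (s - t k) ^ (1 - lam) with hW
  have hsk : 0 < s - t k := by linarith [hs.1]
  have hW0 : 0 ≤ W := by positivity
  -- The first bound for the weight serves the Lipschitz part; the second is combined with the
  -- Hölder power `s^(μ-1/p)`.
  have hWT : W ≤ T ^ (1 - lam) := Real.rpow_le_rpow hsk.le (by linarith) (by linarith)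
  have hWs : W ≤ s ^ (1 - lam) := Real.rpow_le_rpow hsk.le (by linarith) (by linarith)
  have hS (τ : ℝ) (hτ : τ ≤ t k) (y : E) :
      W * ‖opS Q μ ν (s - τ) y‖ ≤ M / Real.Gamma lam * ‖y‖ := by
    have h1 := norm_opS_le hQ hμ0 hμ1 hν0 (show 0 < s - τ by linarith [hs.1]) y
    calc W * ‖opS Q μ ν (s - τ) y‖
        ≤ W * (M / Real.Gamma lam * (s - τ) ^ (lam - 1) * ‖y‖) := by gcongr
      _ = M / Real.Gamma lam * ‖y‖ * (W * (s - τ) ^ (lam - 1)) := by ring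
      _ ≤ M / Real.Gamma lam * ‖y‖ * 1 := by
          gcongr
          exact sub_rpow_mul_sub_rpow_le_one hlam1 hτ hs.1
      _ = _ := mul_one _
  have hIu : 0 ≤ ∫ r in Ioc 0 s, (s - r) ^ (μ - 1) * u r := by
    refine setIntegral_nonneg measurableSet_Ioc fun r hr => ?_
    obtain ⟨j, hj, hjr⟩ := ht.exists_mem_piece (k := k) ⟨hr.1, hr.2.trans hs.2⟩
    have h1 : 0 ≤ s - r := by linarith [hr.2]
    have h2 : 0 ≤ r - t j := by linarith [hjr.1]
    have h3 : 0 ≤ u r := le_trans (by positivity) (hu j hj r hjr)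
    positivity
  set A := ((p - 1) / (p * μ - 1)) ^ (1 - 1 / p) *
    (eLpNorm α (ENNReal.ofReal p) (volume.restrict (Icc 0 T))).toReal with hA
  have hA0 : 0 ≤ A := by
    have : 0 ≤ (p - 1) / (p * μ - 1) := div_nonneg (by linarith) (by linarith)
    positivity
  have hWμ : W * s ^ (μ - 1 / p) ≤ T ^ (ν * (μ - 1) + 1 - 1 / p) := by
    have hexp : 1 - lam + (μ - 1 / p) = ν * (μ - 1) + 1 - 1 / p := by
      rw [hlam_def, hlam]; ring
    have h1p : 1 / p < μ := by rw [div_lt_iff₀ (by linarith)]; linarith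
    calc W * s ^ (μ - 1 / p) ≤ s ^ (1 - lam) * s ^ (μ - 1 / p) := by gcongr
      _ = s ^ (ν * (μ - 1) + 1 - 1 / p) := by rw [← Real.rpow_add hs0, hexp]
      _ ≤ _ := by gcongr; linarith
  have hI := norm_mildIntegral_le hμ0 hμ1 hp ht hQ hg hv hk hu hs hint
  rw [mul_assoc (s ^ (μ - 1 / p)), ← hA] at hI
  have hIW : W * ‖∫ r in Ioc 0 s,
      (s - r) ^ (μ - 1) • opP Q μ (s - r) (relaxedField g r (x r) (v r))‖ ≤
      M * T ^ (ν * (μ - 1) + 1 - 1 / p) / Real.Gamma μ * A +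
      M * T ^ (1 - lam) * L / Real.Gamma μ * ∫ r in Ioc 0 s, (s - r) ^ (μ - 1) * u r := by
    have hL := hg.L_pos.le
    have h1 := mul_le_mul_of_nonneg_right hWμ hA0
    have h2 := mul_le_mul_of_nonneg_right hWT (mul_nonneg hL hIu)
    have h3 := mul_le_mul_of_nonneg_left (add_le_add h1 h2) (show 0 ≤ M / Real.Gamma μ by positivity)
    refine (mul_le_mul_of_nonneg_left hI hW0).trans ?_
    refine le_of_eq_of_le ?_ (h3.trans_eq ?_) <;> ring
  have hsum : W * ‖∑ i ∈ Finset.Icc 1 k, opS Q μ ν (s - t i) (φ i (t i) (x (t i)))‖ ≤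
      M / Real.Gamma lam * ∑ i ∈ Finset.Icc 1 k, ‖φ i (t i) 0‖ +
        M / Real.Gamma lam * ∑ i ∈ Finset.Icc 1 k, h i * ‖x (t i)‖ := by
    rw [← mul_add, ← Finset.sum_add_distrib, Finset.mul_sum]
    refine (mul_le_mul_of_nonneg_left (norm_sum_le _ _) hW0).trans ?_
    rw [Finset.mul_sum]
    refine Finset.sum_le_sum fun i hi => ?_
    rw [Finset.mem_Icc] at hi
    refine (hS (t i) (ht.mono hi.2 (by omega)) _).trans ?_
    refine mul_le_mul_of_nonneg_left ?_ (by positivity)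
    have h1 := hφ.lipschitz i hi.1 (hi.2.trans hk) (x (t i)) 0
    rw [sub_zero] at h1
    have h2 := norm_le_norm_add_norm_sub' (φ i (t i) (x (t i))) (φ i (t i) 0)
    linarith
  have h0 := hS 0 htk x₀
  rw [sub_zero] at h0
  have hnorm := norm_add₃_le (a := opS Q μ ν s x₀)
    (b := ∑ i ∈ Finset.Icc 1 k, opS Q μ ν (s - t i) (φ i (t i) (x (t i))))
    (c := ∫ r in Ioc 0 s, (s - r) ^ (μ - 1) • opP Q μ (s - r) (relaxedField g r (x r) (v r)))
  rw [← hx.eq k hk s hs] at hnorm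
  have h4 := mul_le_mul_of_nonneg_left hnorm hW0
  rw [tau, ← hlam_def, mul_assoc _ (((p - 1) / (p * μ - 1)) ^ (1 - 1 / p)), ← hA,
    mul_div_right_comm M]
  linarith

end Trajectory

/-! ### Gronwall estimates with impulses. -/

section Gronwall

variable {E : Type*} [NormedAddCommGroup E] {n : ℕ} {T : ℝ} {t : ℕ → ℝ}

/-- A Volterra inequality with impulses for the weighted norm of `x`: whenever the weighted norm
is at most `u` up to the `k`-th interval, the stated estimate holds on this interval. -/
def ImpulsiveVolterra (lam μ : ℝ) (n : ℕ) (t : ℕ → ℝ) (τ : ℕ → ℝ) (c : ℝ) (h : ℕ → ℝ) (κ : ℝ)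
    (x : ℝ → E) : Prop :=
  ∀ k ≤ n, ∀ u : ℝ → ℝ, WeightedLE lam t k x u → ∀ s ∈ Ioc (t k) (t (k + 1)),
    IntegrableOn (fun r => (s - r) ^ (μ - 1) * u r) (Ioc 0 s) →
    (s - t k) ^ (1 - lam) * ‖x s‖ ≤ τ k + c * ∑ i ∈ Finset.Icc 1 k, h i * ‖x (t i)‖ +
      κ / Real.Gamma μ * ∫ r in Ioc 0 s, (s - r) ^ (μ - 1) * u r

/-- The total weight `c ∑_{i=1}^k h_i (t_i - t_{i-1})^{λ-1}` of the impulses. -/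
noncomputable def impulseWeight (lam c : ℝ) (t h : ℕ → ℝ) (k : ℕ) : ℝ :=
  c * ∑ i ∈ Finset.range k, h (i + 1) * (t (i + 1) - t i) ^ (lam - 1)

lemma WeightedLE.mono_index {lam : ℝ} {x : ℝ → E} {u : ℝ → ℝ} {j k : ℕ}
    (hu : WeightedLE lam t k x u) (hjk : j ≤ k) : WeightedLE lam t j x u :=
  fun i hi => hu i (hi.trans hjk)

/-- Supplies the starting constant of the iteration; it may depend on `x`. -/
lemma MemPC.exists_weightedLE [NormedSpace ℝ E] {lam : ℝ} {x : ℝ → E} (hx : MemPC lam n t x)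
    {k : ℕ} (hk : k ≤ n) : ∃ K, 0 ≤ K ∧ WeightedLE lam t k x fun _ => K := by
  induction k with
  | zero =>
    obtain ⟨K, hK⟩ := hx.bounded 0 hk
    refine ⟨max K 0, le_max_right _ _, fun j hj s hs => ?_⟩
    obtain rfl : j = 0 := by omega
    exact (hK ⟨s, hs, rfl⟩).trans (le_max_left _ _)
  | succ k ih =>
    obtain ⟨K₀, hK₀, h₀⟩ := ih (by omega)
    obtain ⟨K, hK⟩ := hx.bounded (k + 1) hk
    refine ⟨max K K₀, hK₀.trans (le_max_right _ _), fun j hj s hs => ?_⟩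
    rcases Nat.le_succ_iff.1 hj with hj' | rfl
    · exact (h₀ j hj' s hs).trans (le_max_right _ _)
    · exact (hK ⟨s, hs, rfl⟩).trans (le_max_left _ _)

lemma impulseWeight_mono {lam c : ℝ} {h : ℕ → ℝ} (ht : IsPartition n T t) (hc : 0 ≤ c)
    (hh : ∀ i, 1 ≤ i → i ≤ n → 0 ≤ h i) {j k : ℕ} (hjk : j ≤ k) (hk : k ≤ n) :
    impulseWeight lam c t h j ≤ impulseWeight lam c t h k := by
  refine mul_le_mul_of_nonneg_left (Finset.sum_le_sum_of_subset_of_nonneg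
    (Finset.range_mono hjk) fun i hi _ => ?_) hc
  rw [Finset.mem_range] at hi
  exact mul_nonneg (hh _ (by omega) (by omega))
    (Real.rpow_nonneg (by linarith [ht.lt i (by omega)]) _)

lemma impulseWeight_nonneg {lam c : ℝ} {h : ℕ → ℝ} (ht : IsPartition n T t) (hc : 0 ≤ c)
    (hh : ∀ i, 1 ≤ i → i ≤ n → 0 ≤ h i) {k : ℕ} (hk : k ≤ n) :
    0 ≤ impulseWeight lam c t h k := by
  simpa [impulseWeight] using impulseWeight_mono (lam := lam) ht hc hh (Nat.zero_le k) hk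

/-- The time `t (i+1)` is the right end of the `i`-th interval, so `‖x (t (i+1))‖` is `(t (i+1) - t
i)^(λ-1)` times a weighted norm there. -/
lemma impulse_sum_le {lam c B : ℝ} {h : ℕ → ℝ} {x : ℝ → E} (ht : IsPartition n T t) (hc : 0 ≤ c)
    (hh : ∀ i, 1 ≤ i → i ≤ n → 0 ≤ h i) {j : ℕ} (hj : j ≤ n)
    (hB : ∀ i < j, (t (i + 1) - t i) ^ (1 - lam) * ‖x (t (i + 1))‖ ≤ B) :
    c * ∑ i ∈ Finset.Icc 1 j, h i * ‖x (t i)‖ ≤ impulseWeight lam c t h j * B := by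
  have hsum : ∑ i ∈ Finset.Icc 1 j, h i * ‖x (t i)‖ =
      ∑ i ∈ Finset.range j, h (i + 1) * ‖x (t (i + 1))‖ := by
    rw [Finset.range_eq_Ico, Finset.sum_Ico_add' (fun i => h i * ‖x (t i)‖)]
    rfl
  rw [hsum, impulseWeight, mul_assoc, Finset.sum_mul]
  refine mul_le_mul_of_nonneg_left (Finset.sum_le_sum fun i hi => ?_) hc
  rw [Finset.mem_range] at hi
  have hd : 0 < t (i + 1) - t i := by linarith [ht.lt i (by omega)]
  rw [mul_assoc]
  refine mul_le_mul_of_nonneg_left ?_ (hh _ (by omega) (by omega))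
  calc ‖x (t (i + 1))‖ = (t (i + 1) - t i) ^ (lam - 1) *
        ((t (i + 1) - t i) ^ (1 - lam) * ‖x (t (i + 1))‖) := by
        rw [← mul_assoc, ← Real.rpow_add hd]; simp
    _ ≤ _ := mul_le_mul_of_nonneg_left (hB i hi) (by positivity)

lemma weightedLE_mittagLeffler {lam μ a κ K : ℝ} {k : ℕ} {x : ℝ → E} (hμ0 : 0 < μ)
    (ha : 0 ≤ a) (hκ : 0 ≤ κ) (ht : IsPartition n T t) (hk : k ≤ n)
    (hK : WeightedLE lam t k x fun _ => K)
    (hstep : ∀ m, WeightedLE lam t k x (volterraIterate μ a κ K m) →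
      WeightedLE lam t k x (volterraIterate μ a κ K (m + 1))) :
    WeightedLE lam t k x fun _ => a * mittagLeffler μ (κ * T ^ μ) := by
  have hall : ∀ m, WeightedLE lam t k x (volterraIterate μ a κ K m) := fun m => by
    induction m with
    | zero => exact fun j hj s hs => by simpa [volterraIterate] using hK j hj s hs
    | succ m ih => exact hstep m ih
  intro j hj s hs
  have hs0 : 0 ≤ s := (ht.nonneg (by omega)).trans hs.1.le
  refine (ge_of_tendsto' (tendsto_volterraIterate (a := a) (K := K) hμ0 hκ hs0)
    fun m => hall m j hj s hs).trans (mul_le_mul_of_nonneg_left ?_ ha)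
  refine mittagLeffler_mono hμ0 (by positivity) ?_
  gcongr
  exact hs.2.trans (ht.le_right (by omega))

variable {lam μ c κ : ℝ} {h τ : ℕ → ℝ} {x : ℝ → E}

/-- Gronwall estimate when the impulses are controlled by a known bound `B`. -/
theorem ImpulsiveVolterra.weightedLE_of_bounded_impulses [NormedSpace ℝ E] {k : ℕ} {B : ℝ}
    (hx : ImpulsiveVolterra lam μ n t τ c h κ x) (hxPC : MemPC lam n t x) (hμ0 : 0 < μ)
    (ht : IsPartition n T t) (hc : 0 ≤ c) (hh : ∀ i, 1 ≤ i → i ≤ n → 0 ≤ h i) (hκ : 0 ≤ κ)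
    (hτ0 : ∀ j, 0 ≤ τ j) (hτ : Monotone τ) (hk : k ≤ n) (hB0 : 0 ≤ B)
    (hB : ∀ i < k, (t (i + 1) - t i) ^ (1 - lam) * ‖x (t (i + 1))‖ ≤ B) :
    WeightedLE lam t k x fun _ =>
      (τ k + impulseWeight lam c t h k * B) * mittagLeffler μ (κ * T ^ μ) := by
  obtain ⟨K, -, hK⟩ := hxPC.exists_weightedLE hk
  have hw0 := impulseWeight_nonneg (lam := lam) ht hc hh hk
  refine weightedLE_mittagLeffler hμ0 (add_nonneg (hτ0 k) (mul_nonneg hw0 hB0)) hκ ht hk hK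
    fun m hm j hj s hs => ?_
  have hjn := hj.trans hk
  have hs0 : 0 < s := (ht.nonneg (by omega)).trans_lt hs.1
  have h1 := hx j hjn _ (hm.mono_index hj) s hs
    (integrableOn_kernel_mul_volterraIterate hμ0 hs0 m)
  have h2 := impulse_sum_le ht hc hh hjn fun i hi => hB i (by omega)
  -- Replacing the index `j` by `k` in the weight and in `τ` lets one iteration serve all intervals
  -- up to the `k`-th.
  have h3 := mul_le_mul_of_nonneg_right (impulseWeight_mono (lam := lam) ht hc hh hj hk) hB0
  rw [volterraIterate_succ hμ0 hs0]
  linarith [hτ hj]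

/-- Gronwall estimate absorbing the impulses, when their total weight is less than one. -/
theorem ImpulsiveVolterra.weightedLE_of_impulseWeight_lt_one [NormedSpace ℝ E] {k : ℕ}
    (hx : ImpulsiveVolterra lam μ n t τ c h κ x) (hxPC : MemPC lam n t x) (hμ0 : 0 < μ)
    (ht : IsPartition n T t) (hc : 0 ≤ c) (hh : ∀ i, 1 ≤ i → i ≤ n → 0 ≤ h i) (hκ : 0 ≤ κ)
    (hτ0 : ∀ j, 0 ≤ τ j) (hτ : Monotone τ) (hk : k ≤ n)
    {w : ℝ} (hw : w = 1 - impulseWeight lam c t h k) (hw0 : 0 < w) :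
    WeightedLE lam t k x fun _ => τ k / w * mittagLeffler μ (κ / w * T ^ μ) := by
  obtain ⟨K, hK0, hK⟩ := hxPC.exists_weightedLE hk
  have ha : 0 ≤ τ k / w := div_nonneg (hτ0 k) hw0.le
  have hκw : 0 ≤ κ / w := div_nonneg hκ hw0.le
  refine weightedLE_mittagLeffler hμ0 ha hκw ht hk hK fun m hm => ?_
  intro j
  -- The impulses are estimated by the new iterate, already known to be a majorant on the earlier
  -- intervals, and not by the old one.
  induction j using Nat.strong_induction_on with
  | _ j ih =>
    intro hj s hs
    have hjn := hj.trans hk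
    have hs0 : 0 < s := (ht.nonneg (by omega)).trans_lt hs.1
    have h1 := hx j hjn _ (hm.mono_index hj) s hs
      (integrableOn_kernel_mul_volterraIterate hμ0 hs0 m)
    set V := volterraIterate μ (τ k / w) (κ / w) K (m + 1) s with hV
    have hV0 : 0 ≤ V := by
      rw [hV, volterraIterate]
      have (i : ℕ) := Gamma_mul_natCast_add_one_pos hμ0 i
      have := Finset.sum_nonneg fun i (_ : i ∈ Finset.range (m + 1)) =>
        show 0 ≤ (κ / w * s ^ μ) ^ i / Real.Gamma (μ * i + 1) from
          div_nonneg (by positivity) (this i).le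
      have h5 := Gamma_mul_natCast_add_one_pos hμ0 (m + 1)
      positivity
    have h2 : c * ∑ i ∈ Finset.Icc 1 j, h i * ‖x (t i)‖ ≤ impulseWeight lam c t h j * V := by
      refine impulse_sum_le ht hc hh hjn fun i hi => ?_
      refine (ih i hi (by omega) (t (i + 1)) ⟨ht.lt i (by omega), le_rfl⟩).trans ?_
      exact volterraIterate_mono hμ0 ha hκw hK0 _ (ht.nonneg (by omega))
        ((ht.mono (by omega) (by omega)).trans hs.1.le)
    have h3 := mul_le_mul_of_nonneg_right (impulseWeight_mono (lam := lam) ht hc hh hj hk) hV0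
    have h4 := volterraIterate_succ (a := τ k / w) (κ := κ / w) (K := K) hμ0 hs0 m
    rw [← hV] at h4
    -- The recursion multiplied by `w`. The impulses contribute at most `(1 - w) V`, so the total is
    -- at most `τ j + (1 - w) V + w V - τ k ≤ V`.
    have h5 : κ / Real.Gamma μ * ∫ r in Ioc 0 s, (s - r) ^ (μ - 1) *
        volterraIterate μ (τ k / w) (κ / w) K m r = w * V - τ k := by
      rw [h4]; field_simp; ring
    rw [h5] at h1
    have h6 : impulseWeight lam c t h k = 1 - w := by linarith
    rw [h6] at h3
    linarith [hτ hj]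

lemma WeightedLE.pieceNorm_le [NormedSpace ℝ E] {k : ℕ} {D : ℝ} (ht : IsPartition n T t)
    (hk : k ≤ n) (hD : WeightedLE lam t k x fun _ => D) : pieceNorm lam t k x ≤ D := by
  refine csSup_le ((nonempty_Ioc.2 (ht.lt k hk)).image _) ?_
  rintro _ ⟨s, hs, rfl⟩
  exact hD k le_rfl s hs

/-- A bound for the weighted norm that depends only on the data of the Volterra inequality. -/
theorem exists_weightedLE_of_impulsiveVolterra [NormedSpace ℝ E] (hμ0 : 0 < μ)
    (ht : IsPartition n T t) (hc : 0 ≤ c) (hh : ∀ i, 1 ≤ i → i ≤ n → 0 ≤ h i) (hκ : 0 ≤ κ)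
    (hτ0 : ∀ j, 0 ≤ τ j) (hτ : Monotone τ) {k : ℕ} (hk : k ≤ n) :
    ∃ D, 0 ≤ D ∧ ∀ x : ℝ → E, MemPC lam n t x → ImpulsiveVolterra lam μ n t τ c h κ x →
      WeightedLE lam t k x fun _ => D := by
  -- Induction over the intervals: a bound on the earlier ones controls the impulses. `D` is chosen
  -- before `x`, hence is uniform over trajectories and controls.
  suffices hstep : ∀ k ≤ n, ∀ B, 0 ≤ B → (∀ x : ℝ → E, MemPC lam n t x →
      ImpulsiveVolterra lam μ n t τ c h κ x →
        ∀ i < k, (t (i + 1) - t i) ^ (1 - lam) * ‖x (t (i + 1))‖ ≤ B) →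
      ∃ D, 0 ≤ D ∧ ∀ x : ℝ → E, MemPC lam n t x → ImpulsiveVolterra lam μ n t τ c h κ x →
        WeightedLE lam t k x fun _ => D by
    induction k with
    | zero => exact hstep 0 hk 0 le_rfl fun _ _ _ i hi => absurd hi (by omega)
    | succ k ih =>
      obtain ⟨B, hB0, hB⟩ := ih (by omega)
      exact hstep (k + 1) hk B hB0 fun x hxPC hx i hi =>
        hB x hxPC hx i (by omega) _ ⟨ht.lt i (by omega), le_rfl⟩
  intro k hk B hB0 hB
  refine ⟨max _ 0, le_max_right _ _, fun x hxPC hx j hj s hs =>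
    (hx.weightedLE_of_bounded_impulses hxPC hμ0 ht hc hh hκ hτ0 hτ hk hB0 (hB x hxPC hx)
      j hj s hs).trans (le_max_left _ _)⟩

end Gronwall

/-! ### The constants `τ_k` and the conclusion. -/

lemma tau_nonneg {E : Type*} [NormedAddCommGroup E] {T μ ν p M : ℝ} {t : ℕ → ℝ}
    {φ : ℕ → ℝ → E → E} {x₀ : E} {α : ℝ → ℝ} (hμ0 : 0 < μ) (hμ1 : μ < 1) (hν0 : 0 ≤ ν)
    (hp : 1 / μ < p) (hT : 0 ≤ T) (hM : 0 ≤ M) (k : ℕ) : 0 ≤ tau T t μ ν p M φ x₀ α k := by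
  have hΓlam := Real.Gamma_pos_of_pos (hlam_pos hμ0 hμ1 hν0)
  have hΓ := Real.Gamma_pos_of_pos hμ0
  have hpμ : 1 < p * μ := by rwa [div_lt_iff₀ hμ0] at hp
  have hp1 : 1 < p := lt_trans (by rw [one_lt_div hμ0]; exact hμ1) hp
  have : 0 ≤ (p - 1) / (p * μ - 1) := div_nonneg (by linarith) (by linarith)
  unfold tau
  positivity

lemma tau_mono {E : Type*} [NormedAddCommGroup E] {T μ ν p M : ℝ} {t : ℕ → ℝ}
    {φ : ℕ → ℝ → E → E} {x₀ : E} {α : ℝ → ℝ} (hμ0 : 0 < μ) (hμ1 : μ < 1) (hν0 : 0 ≤ ν)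
    (hM : 0 ≤ M) : Monotone (tau T t μ ν p M φ x₀ α) := fun j k hjk => by
  have hΓlam := Real.Gamma_pos_of_pos (hlam_pos hμ0 hμ1 hν0)
  unfold tau
  gcongr

end HilferRelaxed

theorem mainTheorem5
    {E : Type*} [NormedAddCommGroup E] [NormedSpace ℝ E] [CompleteSpace E]
    {Λ : Type*} [TopologicalSpace Λ] [CompactSpace Λ] [PolishSpace Λ]
    [MeasurableSpace Λ] [BorelSpace Λ]
    (μ ν : ℝ) (hμ0 : 0 < μ) (hμ1 : μ < 1) (hν0 : 0 ≤ ν) (hν1 : ν ≤ 1)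
    (n : ℕ) (T : ℝ) (t : ℕ → ℝ) (ht : IsPartition n T t)
    (A : E →ₗ.[ℝ] E) (Q : ℝ → E →L[ℝ] E) (hQ : IsC0Semigroup Q) (hAQ : IsGenerator A Q)
    (hQcompact : ∀ s : ℝ, 0 < s → IsCompactOperator (Q s))
    (hQbdd : BddAbove ((fun s => ‖Q s‖) '' Set.Ici 0))
    (M : ℝ) (hM : M = semigroupBound Q)
    (p : ℝ) (hp : 1 / μ < p)
    (g : ℝ → E → Λ → E) (α : ℝ → ℝ) (β L : ℝ) (hg : HypG n T t (hlam μ ν) p g α β L)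
    (φ : ℕ → ℝ → E → E) (h : ℕ → ℝ) (hφ : HypH n t (hlam μ ν) M φ h)
    (x₀ : E) :
    (∃ D : ℝ, ∀ (v : ℝ → MeasureTheory.Measure Λ) (x : ℝ → E), IsRelaxedControl T v →
      IsRelaxedTrajectory n t μ ν Q g φ x₀ v x → pcNorm (hlam μ ν) n t x ≤ D) ∧
    ∀ (v : ℝ → MeasureTheory.Measure Λ) (x : ℝ → E), IsRelaxedControl T v →
      IsRelaxedTrajectory n t μ ν Q g φ x₀ v x →
      pieceNorm (hlam μ ν) t 0 x ≤
        tau T t μ ν p M φ x₀ α 0 * mittagLeffler μ (M * T ^ (1 + ν * (μ - 1)) * L) ∧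
      ∀ k, 1 ≤ k → k ≤ n → 0 < wk t (hlam μ ν) M h k →
        pieceNorm (hlam μ ν) t k x ≤
          tau T t μ ν p M φ x₀ α k / wk t (hlam μ ν) M h k *
            mittagLeffler μ (M * T ^ (1 + ν * (μ - 1)) * L / wk t (hlam μ ν) M h k) := by
  have hQM : ∀ s, 0 ≤ s → ‖Q s‖ ≤ M := fun s hs => hM ▸ le_csSup hQbdd ⟨s, hs, rfl⟩
  have hM0 : 0 ≤ M := (norm_nonneg _).trans (hQM 0 le_rfl)
  have hT0 : 0 < T := ht.right ▸ (ht.nonneg (by omega)).trans_lt (ht.lt n le_rfl)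
  have hΓlam := Real.Gamma_pos_of_pos (hlam_pos hμ0 hμ1 hν0)
  have hc : 0 ≤ M / Real.Gamma (hlam μ ν) := by positivity
  have hκ : 0 ≤ M * T ^ (1 - hlam μ ν) * L := by
    have := hg.L_pos
    positivity
  have hh : ∀ i, 1 ≤ i → i ≤ n → 0 ≤ h i := fun i h1 h2 => (hφ.pos i h1 h2).le
  have hτ0 := tau_nonneg (t := t) (φ := φ) (x₀ := x₀) (α := α) hμ0 hμ1 hν0 hp hT0.le hM0
  have hτ := tau_mono (T := T) (t := t) (p := p) (φ := φ) (x₀ := x₀) (α := α) hμ0 hμ1 hν0 hM0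
  have hVol : ∀ (v : ℝ → MeasureTheory.Measure Λ) (x : ℝ → E), IsRelaxedControl T v →
      IsRelaxedTrajectory n t μ ν Q g φ x₀ v x →
      ImpulsiveVolterra (hlam μ ν) μ n t (tau T t μ ν p M φ x₀ α) (M / Real.Gamma (hlam μ ν)) h
        (M * T ^ (1 - hlam μ ν) * L) x := fun v x hv hx k hk u hu s hs hint =>
    weighted_norm_le_of_trajectory hμ0 hμ1 hν0 hν1 hp ht hQM hg hφ hv hx hk hu hs hint
  -- The powers of `T` from the weight and from the Mittag-Leffler argument combine, as `(1 - λ) + μ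
  -- = 1 + ν(μ - 1)`.
  have hconst (w : ℝ) : M * T ^ (1 - hlam μ ν) * L / w * T ^ μ =
      M * T ^ (1 + ν * (μ - 1)) * L / w := by
    rw [show 1 + ν * (μ - 1) = (1 - hlam μ ν) + μ by unfold hlam; ring, Real.rpow_add hT0]
    ring
  refine ⟨?_, fun v x hv hx => ?_⟩
  · obtain ⟨D, -, hD⟩ := exists_weightedLE_of_impulsiveVolterra (E := E) (lam := hlam μ ν) hμ0 ht hc
      hh hκ hτ0 hτ le_rfl
    refine ⟨D, fun v x hv hx => Finset.sup'_le _ _ fun k hk => ?_⟩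
    have hkn : k ≤ n := Nat.lt_succ_iff.1 (Finset.mem_range.1 hk)
    exact ((hD x hx.memPC (hVol v x hv hx)).mono_index hkn).pieceNorm_le ht hkn
  · have hpiece : ∀ k ≤ n, 0 < wk t (hlam μ ν) M h k → pieceNorm (hlam μ ν) t k x ≤
        tau T t μ ν p M φ x₀ α k / wk t (hlam μ ν) M h k *
          mittagLeffler μ (M * T ^ (1 + ν * (μ - 1)) * L / wk t (hlam μ ν) M h k) :=
      fun k hk hw => by
        rw [← hconst]
        exact ((hVol v x hv hx).weightedLE_of_impulseWeight_lt_one hx.memPC hμ0 ht hc hh hκ hτ0 hτ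
          hk rfl hw).pieceNorm_le ht hk
    refine ⟨?_, fun k _ hk hw => hpiece k hk hw⟩
    -- For `k = 0` the impulse sum is empty, so the first bound is the case `w = 1` of the general
    -- one.
    have hw0 : wk t (hlam μ ν) M h 0 = 1 := by simp [wk]
    simpa [hw0] using hpiece 0 (Nat.zero_le n) (by rw [hw0]; exact one_pos)
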